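/- **Setting.** A *two-layer $\tanh$ network* on $\{\pm1\}^n$ is a function $v(x)=b^{(1)}+\sum_j w_j\tanh\big(b^{(2)}_j+\sum_i W_{ji}x_i\big)$ with finitely many hidden units $j$; write $\|w\|_1=\sum_j|w_j|$ and $\lambda=\max_j\|W_j\|_1$ with $\|W_j\|_1=\sum_i|W_{ji}|$. Its *model* is the law of $(X,Y)$ with $X$ uniform on $\{\pm1\}^n$, $Y\in\{\pm1\}$ and $\mathbb E[Y\mid X]=\tanh(v(X))$. With the logistic loss $\ell(v,y)=\log(1+e^{-2vy})$, a hypothesis $h:\{\pm1\}^n\to\mathbb R$ has *error* at most $\epsilon$ if $\mathbb E[\ell(h(X),Y)]\le\mathbb E[\ell(v(X),Y)]+\epsilon$. An *algorithm* in dimension $n$ is a randomized Boolean circuit (over all binary Boolean gates, possibly a different one for each $n$) whose input bits are those of any number of i.i.d. samples $(X,Y)$ and of independent fair coins. A *testing* algorithm outputs one bit; a *learning* algorithm has a further input $x\in\{\pm1\}^n$ and outputs, as a fixed-point binary number, the value at $x$ of the hypothesis computed from its samples and coins. The *runtime* is the number of samples, coins, gates and (for learners) output bits. An algorithm *learns*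 a set $F_n$ of networks on $\{\pm1\}^n$ to error $\epsilon$ if for every network in $F_n$, on samples from its model, its hypothesis has error at most $\epsilon$ with probability at least $2/3$. Saying that a task *requires runtime* $n^{\Omega(e_n)}$ means: there is $c>0$ such that for all sufficiently large $n$ every algorithm performing it in dimension $n$ has runtime at least $n^{c e_n}$. For $\eta\in(0,1/2)$, *$k$-sparse parity with noise* for an unknown $S\subseteq[n]$, $|S|=k$, is the law of $(X,Y)$ with $X$ uniform on $\{\pm1\}^n$ and $Y=\prod_{s\in S}X_s$ with probability $1/2+\eta$, $Y=-\prod_{s\in S}X_s$ with probability $1/2-\eta$. The testing problem is to distinguish it from the uniform law on $\{\pm1\}^n\times\{\pm1\}$ so that, for every $S$ of size $k$, the probabilities of the errors of type I and type II sum to at most $0.01$. **Hardness assumption.** For every fixed $\eta\in(0,1/2)$ and every sequence of positive integers $k_n$ with $k_n=o(n^{1-\delta})$ for some $\delta>0$, the $k_n$-sparse parity with noise testing problem in dimension $n$ requires runtime $n^{\Omega(k_n)}$. **Theorem.** Under the hardness assumption, the following hold. 1. (Constant $\epsilon$.) There is a constant $\epsilon_0>0$ such that for every sequence $R_n\to\infty$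 with $\frac{\log R_n}{\log\log R_n}=O(n^{1-\delta})$ for some $\delta>0$ there are sets $F_n$ of two-layer $\tanh$ networks on $\{\pm1\}^n$, all with $\lambda\le2$ and $\|w\|_1=R_n$ for large $n$, such that learning $F_n$ to error $\epsilon_0$ requires runtime $$n^{\Omega\left(\frac{\log(\|w\|_1/\epsilon_0)}{\log\log(\|w\|_1/\epsilon_0)}\right)}.$$ 2. (Constant $\|w\|_1$.) There is a constant $w_0>0$ such that for every sequence $\epsilon_n>0$ with $\epsilon_n\to0$ and $\frac{\log(1/\epsilon_n)}{\log\log(1/\epsilon_n)}=O(n^{1-\delta})$ for some $\delta>0$ there are sets $F_n$ of two-layer $\tanh$ networks on $\{\pm1\}^n$, all with $\lambda\le2$ and $\|w\|_1=w_0$ for large $n$, such that learning $F_n$ to error $\epsilon_n$ requires runtime $$n^{\Omega\left(\frac{\log(\|w\|_1/\epsilon_n)}{\log\log(\|w\|_1/\epsilon_n)}\right)}.$$ 3. There are sequences $\lambda_n=\Theta(n\log n)$ and $R_n=\Theta(\sqrt n)$ and sets $F_n$ of two-layer $\tanh$ networks on $\{\pm1\}^n$, all with $\lambda=\lambda_n$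 and $\|w\|_1=R_n$ for large $n$, such that learning $F_n$ to error $0.01$ requires runtime $$n^{\Omega\left(\sqrt{\lambda_n/\log^3\lambda_n}\,\log\|w\|_1\right)}.$$ -/

import Mathlib

open Filter Topology Asymptotics MeasureTheory

noncomputable section

/-! ### Algorithms: randomized Boolean circuits that read i.i.d. samples -/

/-- Boolean circuits with `q` output bits whose available wires are indexed by `ι`, over the basis
of all binary Boolean functions. `gate f a b C` computes `f` of the wires `a` and `b`, makes the
result available as the new wire `none`, and continues with `C`; `done out` selects the output
wires. -/
inductive Circuit (q : ℕ) : Type → Type 1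
  | done {ι : Type} (out : Fin q → ι) : Circuit q ι
  | gate {ι : Type} (f : Bool → Bool → Bool) (a b : ι) (C : Circuit q (Option ι)) : Circuit q ι

/-- The output bits of a circuit on given input bits. -/
def Circuit.eval {q : ℕ} : {ι : Type} → Circuit q ι → (ι → Bool) → Fin q → Bool
  | _, .done out, x => fun i => x (out i)
  | _, .gate f a b C, x => C.eval (fun o => o.elim (f (x a) (x b)) x)

/-- The number of gates. -/
def Circuit.size {q : ℕ} : {ι : Type} → Circuit q ι → ℕ
  | _, .done _ => 0
  | _, .gate _ _ _ C => C.size + 1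

/-- The bit `true` encodes `+1` and the bit `false` encodes `-1`. -/
def sgn (b : Bool) : ℝ := if b then 1 else -1

/-- Labelled points `(x, y)` with `x ∈ {±1}ⁿ` and `y ∈ {±1}`. -/
abbrev LabelledPoint (n : ℕ) : Type := (Fin n → Bool) × Bool

/-- The `n + 1` bits of each of `m` labelled points; `none` is the label. -/
def sampleBits {n m : ℕ} (z : Fin m → LabelledPoint n) : Fin m × Option (Fin n) → Bool
  | (i, some j) => (z i).1 j
  | (i, none) => (z i).2

/-- The joint law of `m` independent samples from `D` and `r` independent fair coins. -/
def sampleLaw {n : ℕ} (D : Measure (LabelledPoint n)) (m r : ℕ) :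
    Measure ((Fin m → LabelledPoint n) × (Fin r → Bool)) :=
  (Measure.pi fun _ : Fin m => D).prod (PMF.uniformOfFintype (Fin r → Bool)).toMeasure

/-- A randomized algorithm that draws samples in `{±1}ⁿ × {±1}` and answers with one bit. -/
structure Tester (n : ℕ) where
  samples : ℕ
  coins : ℕ
  circuit : Circuit 1 ((Fin samples × Option (Fin n)) ⊕ Fin coins)

/-- One step for each sample drawn, each coin tossed and each gate. -/
def Tester.runtime {n : ℕ} (A : Tester n) : ℕ := A.samples + A.coins + A.circuit.size

/-- The probability of the answer `b` on samples from `D`. -/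
def Tester.prob {n : ℕ} (A : Tester n) (D : Measure (LabelledPoint n)) (b : Bool) : ℝ :=
  (sampleLaw D A.samples A.coins).real
    {ω | A.circuit.eval (Sum.elim (sampleBits ω.1) ω.2) 0 = b}

/-- The real number with sign bit `b 0`, with magnitude bits `b 1, …, b q` (least significant
first), of which `p` stand after the binary point. -/
def fixedPoint (p : ℕ) {q : ℕ} (b : Fin (q + 1) → Bool) : ℝ :=
  sgn (b 0) * (∑ i : Fin q, if b i.succ then (2 : ℝ) ^ (i : ℕ) else 0) / 2 ^ p

/-- A randomized learning algorithm for regression functions on `{±1}ⁿ`: from its samples and coins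
it computes a hypothesis `{±1}ⁿ → ℝ`. The circuit comprises training and the evaluation of the
hypothesis at an additional input point; the value is output in binary. -/
structure Learner (n : ℕ) where
  samples : ℕ
  coins : ℕ
  digits : ℕ
  fracDigits : ℕ
  circuit : Circuit (digits + 1) ((Fin samples × Option (Fin n)) ⊕ (Fin coins ⊕ Fin n))

/-- One step for each sample drawn, each coin tossed, each gate and each output bit. -/
def Learner.runtime {n : ℕ} (A : Learner n) : ℕ :=
  A.samples + A.coins + A.circuit.size + (A.digits + 1)

/-- The hypothesis returned on the samples `z` and coins `u`. -/
def Learner.hypothesis {n : ℕ} (A : Learner n) (z : Fin A.samples → LabelledPoint n)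
    (u : Fin A.coins → Bool) (x : Fin n → Bool) : ℝ :=
  fixedPoint A.fracDigits (A.circuit.eval (Sum.elim (sampleBits z) (Sum.elim u x)))

/-! ### Distributions -/

/-- The law of `(X, Y)` with `X` uniform on `{±1}ⁿ` and `Y ∈ {±1}` with `E[Y | X] = g X`
(for `|g| ≤ 1`), i.e. `P(Y = y | X = x) = (1 + y g(x)) / 2`. -/
def labelledLaw {n : ℕ} (g : (Fin n → Bool) → ℝ) : Measure (LabelledPoint n) :=
  ∑ x : Fin n → Bool, ∑ b : Bool,
    ENNReal.ofReal ((1 + sgn b * g x) / 2 / 2 ^ n) • Measure.dirac (x, b)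

/-- The uniform law on `{±1}ⁿ × {±1}`. -/
def uniformLaw (n : ℕ) : Measure (LabelledPoint n) := labelledLaw fun _ => 0

/-- Sparse parity with noise: `X` is uniform, and `Y = ∏_{s ∈ S} X_s` with probability `1/2 + η`,
`Y = -∏_{s ∈ S} X_s` with probability `1/2 - η`. -/
def parityLaw {n : ℕ} (S : Finset (Fin n)) (η : ℝ) : Measure (LabelledPoint n) :=
  labelledLaw fun x => 2 * η * ∏ s ∈ S, sgn (x s)

/-- The tester answers `true` for "parity" and `false` for "uniform". For every `k`-set `S`, the
sum of the probabilities of errors of type I and type II is at most `0.01`. -/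
def Tester.SolvesParity {n : ℕ} (A : Tester n) (k : ℕ) (η : ℝ) : Prop :=
  ∀ S : Finset (Fin n), S.card = k →
    A.prob (uniformLaw n) true + A.prob (parityLaw S η) false ≤ 1 / 100

/-- Hardness of sparse parity with noise: for every fixed `η ∈ (0, 1/2)` and every sequence `k` of
positive integers with `k n = o(n ^ (1 - δ))` for some `δ > 0`, testing `k n`-sparse parity with
noise in dimension `n` requires runtime `n ^ Ω(k n)`. -/
def SparseParityHard : Prop :=
  ∀ η : ℝ, 0 < η → η < 1 / 2 → ∀ k : ℕ → ℕ, (∀ n, 0 < k n) →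
    (∃ δ : ℝ, 0 < δ ∧ (fun n => (k n : ℝ)) =o[atTop] fun n => (n : ℝ) ^ (1 - δ)) →
    ∃ c : ℝ, 0 < c ∧ ∀ᶠ n in atTop, ∀ A : Tester n, A.SolvesParity (k n) η →
      (n : ℝ) ^ (c * k n) ≤ A.runtime

/-! ### Two-layer networks -/

/-- A two-layer network with `tanh` hidden units and input dimension `n`. -/
structure TanhNet (n : ℕ) where
  hidden : ℕ
  bias : ℝ
  w : Fin hidden → ℝ
  hiddenBias : Fin hidden → ℝ
  W : Fin hidden → Fin n → ℝ

/-- `v(x) = b⁽¹⁾ + ∑ⱼ wⱼ tanh(b⁽²⁾ⱼ + ∑ᵢ Wⱼᵢ xᵢ)`. -/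
def TanhNet.value {n : ℕ} (N : TanhNet n) (x : Fin n → Bool) : ℝ :=
  N.bias + ∑ j, N.w j * Real.tanh (N.hiddenBias j + ∑ i, N.W j i * sgn (x i))

/-- `‖w‖₁`. -/
def TanhNet.outNorm {n : ℕ} (N : TanhNet n) : ℝ := ∑ j, |N.w j|

/-- `λ = maxⱼ ‖Wⱼ‖₁`, the largest `ℓ₁` norm of the weights into a hidden unit. -/
def TanhNet.hiddenNorm {n : ℕ} (N : TanhNet n) : ℝ := ⨆ j, ∑ i, |N.W j i|

/-- The model given by a network: `X` is uniform on `{±1}ⁿ` and `E[Y | X] = tanh (v(X))`. -/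
def TanhNet.law {n : ℕ} (N : TanhNet n) : Measure (LabelledPoint n) :=
  labelledLaw fun x => Real.tanh (N.value x)

/-- The logistic loss. -/
def logisticLoss (v y : ℝ) : ℝ := Real.log (1 + Real.exp (-2 * v * y))

/-- Expected logistic loss of a predictor. -/
def risk {n : ℕ} (D : Measure (LabelledPoint n)) (h : (Fin n → Bool) → ℝ) : ℝ :=
  ∫ z, logisticLoss (h z.1) (sgn z.2) ∂D

/-- On samples from the model of any network of the family `F`, the learner returns, with
probability at least `2/3`, a hypothesis whose expected logistic loss exceeds that of the optimal
predictor `v` by at most `ε`. -/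
def Learner.Learns {n : ℕ} (A : Learner n) (F : Set (TanhNet n)) (ε : ℝ) : Prop :=
  ∀ N ∈ F, 2 / 3 ≤ (sampleLaw N.law A.samples A.coins).real
    {ω | risk N.law (A.hypothesis ω.1 ω.2) - risk N.law N.value ≤ ε}

/-- Learning the families `F n` to error `ε n` requires runtime `n ^ Ω(e n)`. -/
def RequiresRuntime (F : (n : ℕ) → Set (TanhNet n)) (ε e : ℕ → ℝ) : Prop :=
  ∃ c : ℝ, 0 < c ∧ ∀ᶠ n in atTop, ∀ A : Learner n, A.Learns (F n) (ε n) →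
    (n : ℝ) ^ (c * e n) ≤ A.runtime

/-- `log t / log log t`. -/
def logRatio (t : ℝ) : ℝ := Real.log t / Real.log (Real.log t)

end

/-! If the networks in `F n` represent `θ χ_S` for every parity `χ_S` with `|S| = k`, in the sense
that `tanh (v x) = θ χ_S(x)` exactly, then their models are noisy `k`-sparse parities, and a learner
for `F n` yields a parity tester. The proof consists of this reduction and of the construction of
cheap networks.

Reduction (`exists_tester_solvesParity`). Let `θ = 2^(-m) / 2`. Samples of parity with `η = 1/4`
become samples of the model when each training label is kept with probability `2^(-m)` and otherwise
replaced by a fair coin (`map_mixPoints`). An excess risk of at most `θ² / 25` forces the sign of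
the hypothesis to agree with `χ_S` at most points (`correlation_ge`). The sign is compared with the
labels of fresh samples that carry no added noise, so a constant number of test points suffices
however small `θ` is. For uniform labels the same statistic has mean zero. A constant number of
repetitions lowers the failure probability, and the runtime grows by a factor `K (m + 1)`, which is
negligible against `n ^ (c k)` once `k → ∞`.

Construction. If every hidden unit has the weights `a` on `S` and `0` elsewhere, the network depends
only on the number `t` of coordinates in `S` equal to `+1`, so the task is to interpolate `±artanh
θ` with alternating signs at `k + 1` points by translates of one `tanh`. Flat units, `a = 1/k`, lead
to a Cauchy system whose solution has `ℓ₁` norm at most `artanh θ * (k + 1) ^ (36 k)`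
(`tanhRepresents_inv`). Hence `k` of order `log (‖w‖₁/ε) / log log (‖w‖₁/ε)` is reachable, which
gives the first two claims. Steep units, `a ≥ 1`, lead to a diagonally dominant system, and norm `2
k` suffices (`tanhRepresents_of_one_le`). This gives the third claim with `k` of order `√n`. -/

noncomputable section

/-! ### Composing circuits -/

/-- Rename the wires of a circuit. -/
def Circuit.map {q : ℕ} : {ι κ : Type} → (ι → κ) → Circuit q ι → Circuit q κ
  | _, _, σ, .done out => .done (σ ∘ out)
  | _, _, σ, .gate f a b C => .gate f (σ a) (σ b) (C.map (Option.map σ))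

theorem Circuit.size_map {q : ℕ} {ι κ : Type} (σ : ι → κ) (C : Circuit q ι) :
    (C.map σ).size = C.size := by
  induction C generalizing κ with
  | done out => rfl
  | gate f a b C ih => simp [Circuit.map, Circuit.size, ih]

theorem Circuit.eval_map {q : ℕ} {ι κ : Type} (σ : ι → κ) (C : Circuit q ι) (x : κ → Bool) :
    (C.map σ).eval x = C.eval (x ∘ σ) := by
  induction C generalizing κ with
  | done out => rfl
  | gate f a b C ih =>
    simp only [Circuit.map, Circuit.eval, ih]
    congr 1
    funext o
    cases o <;> rfl

/-- The bits `f x` can be added to the wires `x` of any circuit at the cost of `s` gates. -/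
def Computes {ι κ : Type} (f : (ι → Bool) → κ → Bool) (s : ℕ) : Prop :=
  ∀ (q : ℕ) (ν : Type) (σ : ι → ν) (D : Circuit q (ν ⊕ κ)), ∃ E : Circuit q ν,
    E.size ≤ D.size + s ∧ ∀ x, E.eval x = D.eval (Sum.elim x (f (x ∘ σ)))

namespace Computes

variable {ι κ κ' μ : Type} {s t : ℕ}

theorem mono {f : (ι → Bool) → κ → Bool} (h : Computes f s) (hst : s ≤ t) : Computes f t := by
  intro q ν σ D
  obtain ⟨E, hE, h'⟩ := h q ν σ D
  exact ⟨E, by omega, h'⟩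

theorem exists_circuit {q : ℕ} {f : (ι → Bool) → Fin q → Bool} (h : Computes f s) :
    ∃ C : Circuit q ι, C.size ≤ s ∧ ∀ x, C.eval x = f x := by
  obtain ⟨E, hE, h'⟩ := h q ι id (.done Sum.inr)
  exact ⟨E, by simpa [Circuit.size] using hE, fun x => by rw [h']; rfl⟩

theorem wires (ρ : κ → ι) : Computes (fun x : ι → Bool => x ∘ ρ) 0 := by
  intro q ν σ D
  refine ⟨D.map (Sum.elim id (σ ∘ ρ)), by simp [Circuit.size_map], fun x => ?_⟩
  rw [Circuit.eval_map]
  congr 1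
  funext o
  cases o <;> rfl

/-- Because `Computes` quantifies over the circuit that follows, the sequential composition of
circuits is a composition of two such extensions, and all earlier wires stay available. -/
theorem comp {g : (κ → Bool) → μ → Bool} {f : (ι → Bool) → κ → Bool}
    (hg : Computes g t) (hf : Computes f s) : Computes (fun x => g (f x)) (s + t) := by
  intro q ν σ D
  obtain ⟨E₁, h₁, e₁⟩ := hg q (ν ⊕ κ) Sum.inr (D.map (Sum.map Sum.inl id))
  obtain ⟨E, h, e⟩ := hf q ν σ E₁
  refine ⟨E, by rw [Circuit.size_map] at h₁; omega, fun x => ?_⟩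
  rw [e, e₁, Circuit.eval_map]
  congr 1
  funext o
  cases o <;> rfl

theorem pair {f : (ι → Bool) → κ → Bool} {g : (ι → Bool) → κ' → Bool}
    (hf : Computes f s) (hg : Computes g t) :
    Computes (fun x => Sum.elim (f x) (g x)) (s + t) := by
  intro q ν σ D
  obtain ⟨E₁, h₁, e₁⟩ := hg q (ν ⊕ κ) (Sum.inl ∘ σ)
    (D.map (Sum.elim (Sum.inl ∘ Sum.inl) (Sum.elim (Sum.inl ∘ Sum.inr) Sum.inr)))
  obtain ⟨E, h, e⟩ := hf q ν σ E₁
  refine ⟨E, by rw [Circuit.size_map] at h₁; omega, fun x => ?_⟩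
  rw [e, e₁, Circuit.eval_map]
  congr 1
  funext o
  rcases o with o | o | o <;> rfl

theorem relabel {f : (ι → Bool) → κ → Bool} (hf : Computes f s) (ρ : κ' → κ) :
    Computes (fun x i => f x (ρ i)) s :=
  (comp (wires ρ) hf).mono (by simp)

theorem gate (f : Bool → Bool → Bool) (a b : ι) :
    Computes (fun (x : ι → Bool) (_ : Unit) => f (x a) (x b)) 1 := by
  intro q ν σ D
  refine ⟨.gate f (σ a) (σ b) (D.map (Sum.elim some fun _ => none)),
    by simp [Circuit.size, Circuit.size_map], fun x => ?_⟩
  rw [Circuit.eval, Circuit.eval_map]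
  congr 1
  funext o
  cases o <;> rfl

theorem of_circuit {q : ℕ} (C : Circuit q ι) : Computes C.eval C.size := by
  unfold Computes
  induction C with
  | done out =>
    intro p ν σ D
    refine ⟨D.map (Sum.elim id (σ ∘ out)), by simp [Circuit.size, Circuit.size_map], fun x => ?_⟩
    rw [Circuit.eval_map]
    congr 1
    funext o
    cases o <;> rfl
  | gate f a b C ih =>
    intro p ν σ D
    obtain ⟨E, h, e⟩ := ih p (Option ν) (Option.map σ) (D.map (Sum.map some id))
    refine ⟨.gate f (σ a) (σ b) E, ?_, fun x => ?_⟩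
    · simp only [Circuit.size, Circuit.size_map] at h ⊢
      omega
    · rw [Circuit.eval, e, Circuit.eval_map]
      congr 1
      funext o
      rcases o with o | o
      · rfl
      · simp only [Circuit.eval, Function.comp_apply, Sum.map_inr, id_eq, Sum.elim_inr]
        congr 1
        funext o
        cases o <;> rfl

theorem empty [IsEmpty κ] (f : (ι → Bool) → κ → Bool) : Computes f 0 := by
  intro q ν σ D
  refine ⟨D.map (Sum.elim id isEmptyElim), by simp [Circuit.size_map], fun x => ?_⟩
  rw [Circuit.eval_map]
  congr 1
  funext o
  rcases o with o | o
  · rfl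
  · exact isEmptyElim o

theorem family {τ : Type} [Fintype τ] {f : τ → (ι → Bool) → κ → Bool}
    (h : ∀ i, Computes (f i) s) :
    Computes (fun x (p : τ × κ) => f p.1 x p.2) (Fintype.card τ * s) := by
  have key : ∀ (T : ℕ) (g : Fin T → (ι → Bool) → κ → Bool), (∀ i, Computes (g i) s) →
      Computes (fun x (p : Fin T × κ) => g p.1 x p.2) (T * s) := by
    intro T
    induction T with
    | zero => intro g _; simpa using empty _
    | succ T ih =>
      intro g hg
      have h1 := (pair (hg 0) (ih (fun i => g i.succ) fun i => hg _)).relabel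
        (κ' := Fin (T + 1) × κ)
        (fun p => Fin.cases (motive := fun _ => κ ⊕ (Fin T × κ)) (Sum.inl p.2)
          (fun i => Sum.inr (i, p.2)) p.1)
      convert h1 using 1
      · funext x p
        obtain ⟨i, a⟩ := p
        induction i using Fin.cases <;> rfl
      · ring
  have h2 := (key _ (fun i => f ((Fintype.equivFin τ).symm i)) fun i => h _).relabel
    (κ' := τ × κ) (fun p => (Fintype.equivFin τ p.1, p.2))
  simpa using h2

theorem mux_wires (c a b : ι) :
    Computes (fun (x : ι → Bool) (_ : Unit) => bif x c then x a else x b) 3 := by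
  convert (gate (fun u v => u || v) (Sum.inl ()) (Sum.inr ())).comp
    ((gate (fun u v => u && v) c a).pair (gate (fun u v => !u && v) c b)) using 3 with x
  simp only [Sum.elim_inl, Sum.elim_inr]
  cases x c <;> simp

theorem mux {c a b : (ι → Bool) → Unit → Bool} {r : ℕ} (hc : Computes c r) (ha : Computes a s)
    (hb : Computes b t) :
    Computes (fun x (_ : Unit) => bif c x () then a x () else b x ()) (r + s + t + 3) :=
  ((mux_wires (Sum.inl (Sum.inl ())) (Sum.inl (Sum.inr ())) (Sum.inr ())).comp
    ((hc.pair ha).pair hb)).mono le_rfl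

/-- Every Boolean function of a nonempty set of bits is computed by a circuit, of a size that
depends only on the number of bits. -/
theorem exists_forall (ι : Type) [Fintype ι] [Nonempty ι] :
    ∃ s, ∀ f : (ι → Bool) → Unit → Bool, Computes f s := by
  have key : ∀ M : ℕ, ∃ s, ∀ f : (Fin (M + 1) → Bool) → Unit → Bool, Computes f s := by
    intro M
    induction M with
    | zero =>
      refine ⟨1, fun f => ?_⟩
      convert gate (fun u _ => f (fun _ => u) ()) (0 : Fin 1) 0 using 3 with x i
      funext j
      rw [show j = 0 from Fin.ext (by omega)]
    | succ M ih =>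
      obtain ⟨s, hs⟩ := ih
      -- Shannon expansion: the first bit selects between the two restrictions of `f`, and the
      -- multiplexer costs 3 gates.
      refine ⟨0 + (0 + s) + (0 + s) + 3, fun f => ?_⟩
      have h (b : Bool) : Computes
          (fun (x : Fin (M + 2) → Bool) (_ : Unit) => f (Fin.cons b (x ∘ Fin.succ)) ()) (0 + s) :=
        (hs fun x _ => f (Fin.cons b x) ()).comp (wires Fin.succ)
      convert mux (wires (fun _ => (0 : Fin (M + 2)))) (h true) (h false) using 3 with x i
      have hx (b : Bool) (hb : x 0 = b) : x = Fin.cons b (x ∘ Fin.succ) := by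
        rw [← hb]
        exact (Fin.cons_self_tail x).symm
      simp only [Function.comp_apply]
      cases hb : x 0
      · exact congrArg (fun y => f y i) (hx _ hb)
      · exact congrArg (fun y => f y i) (hx _ hb)
  obtain ⟨M, hM⟩ : ∃ M, Fintype.card ι = M + 1 := ⟨_, (Nat.succ_pred Fintype.card_ne_zero).symm⟩
  obtain ⟨s, hs⟩ := key M
  let e : ι ≃ Fin (M + 1) := Fintype.equivFinOfCardEq hM
  refine ⟨0 + s, fun f => ?_⟩
  convert (hs fun x => f (x ∘ e)).comp (wires e.symm) using 2 with x
  congr 1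
  funext i
  simp

end Computes

/-! ### Adding noise to a bit -/

/-- Replace `y` by `u` unless all the bits `c` are true. -/
def mix (u : Bool) : (m : ℕ) → (Fin m → Bool) → Bool → Bool
  | 0, _, y => y
  | m + 1, c, y => bif c 0 then mix u m (c ∘ Fin.succ) y else u

theorem computes_mix {ι : Type} (u : ι) (m : ℕ) (c : Fin m → ι) (y : ι) :
    Computes (fun x (_ : Unit) => mix (x u) m (x ∘ c) (x y)) (3 * m) := by
  induction m with
  | zero => exact Computes.wires fun _ => y
  | succ m ih =>
    exact (Computes.mux (Computes.wires fun _ => c 0) (ih (c ∘ Fin.succ))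
      (Computes.wires fun _ => u)).mono (by omega)

theorem sum_sgn : ∑ b : Bool, sgn b = 0 := by simp [sgn]

/-- Whenever some bit of `c` is false the result is `u`, and these terms cancel in the sum over `u`.
Only the all-true `c` survives, once for each value of `u`. -/
theorem sum_sgn_mix (m : ℕ) (y : Bool) :
    ∑ u : Bool, ∑ c : Fin m → Bool, sgn (mix u m c y) = 2 * sgn y := by
  induction m with
  | zero => simp [mix, two_mul]
  | succ m ih =>
    have h (u : Bool) : ∑ c : Fin (m + 1) → Bool, sgn (mix u (m + 1) c y) =
        ∑ c : Fin m → Bool, sgn (mix u m c y) + 2 ^ m * sgn u := by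
      rw [← (Fin.consEquiv fun _ : Fin (m + 1) => Bool).sum_comp, Fintype.sum_prod_type]
      have hc (b : Bool) (c : Fin m → Bool) :
          (Fin.cons b c : Fin (m + 1) → Bool) ∘ Fin.succ = c := rfl
      simp [mix, Fin.consEquiv, hc]
    simp_rw [h, Finset.sum_add_distrib, ← Finset.mul_sum, sum_sgn, ih]
    simp

/-! ### The laws of samples and coins -/

theorem measureReal_setOf_eq_sum {Ω : Type*} [Fintype Ω] [MeasurableSpace Ω]
    [MeasurableSingletonClass Ω] (μ : Measure Ω) [IsFiniteMeasure μ] (p : Ω → Prop)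
    [DecidablePred p] : μ.real {ω | p ω} = ∑ ω, if p ω then μ.real {ω} else 0 := by
  rw [← Finset.sum_filter, sum_measureReal_singleton]
  simp

theorem labelledLaw_weight_nonneg {n : ℕ} {g : (Fin n → Bool) → ℝ} (hg : ∀ x, |g x| ≤ 1)
    (x : Fin n → Bool) (b : Bool) : 0 ≤ (1 + sgn b * g x) / 2 / 2 ^ n := by
  have h := abs_le.1 (hg x)
  have : 0 ≤ 1 + sgn b * g x := by
    cases b <;> simp [sgn] <;> linarith
  positivity

theorem labelledLaw_singleton {n : ℕ} (g : (Fin n → Bool) → ℝ) (x : Fin n → Bool) (b : Bool) :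
    labelledLaw g {(x, b)} = ENNReal.ofReal ((1 + sgn b * g x) / 2 / 2 ^ n) := by
  rw [labelledLaw, Measure.finsetSum_apply, Finset.sum_eq_single x, Measure.finsetSum_apply,
    Finset.sum_eq_single b]
  · simp
  · intro c _ hc
    simp [hc]
  · simp
  · intro y _ hy
    rw [Measure.finsetSum_apply]
    simp [hy]
  · simp

theorem labelledLaw_real_singleton {n : ℕ} {g : (Fin n → Bool) → ℝ} (hg : ∀ x, |g x| ≤ 1)
    (x : Fin n → Bool) (b : Bool) :
    (labelledLaw g).real {(x, b)} = (1 + sgn b * g x) / 2 / 2 ^ n := by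
  rw [measureReal_def, labelledLaw_singleton,
    ENNReal.toReal_ofReal (labelledLaw_weight_nonneg hg x b)]

theorem labelledLaw_isProbabilityMeasure {n : ℕ} {g : (Fin n → Bool) → ℝ}
    (hg : ∀ x, |g x| ≤ 1) : IsProbabilityMeasure (labelledLaw g) := by
  constructor
  have h : ∀ x : Fin n → Bool, ∑ b : Bool, (1 + sgn b * g x) / 2 / 2 ^ n = ((2 : ℝ) ^ n)⁻¹ := by
    intro x
    simp [sgn]
    ring
  rw [← Finset.coe_univ, ← sum_measure_singleton, Fintype.sum_prod_type]
  simp_rw [labelledLaw_singleton]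
  simp_rw [← ENNReal.ofReal_sum_of_nonneg (fun b _ => labelledLaw_weight_nonneg hg _ b), h]
  rw [← ENNReal.ofReal_sum_of_nonneg (fun _ _ => by positivity)]
  simp

theorem integral_labelledLaw {n : ℕ} {g : (Fin n → Bool) → ℝ} (hg : ∀ x, |g x| ≤ 1)
    (f : LabelledPoint n → ℝ) :
    ∫ z, f z ∂labelledLaw g =
      (∑ x, ((1 + g x) / 2 * f (x, true) + (1 - g x) / 2 * f (x, false))) / 2 ^ n := by
  have := labelledLaw_isProbabilityMeasure hg
  rw [integral_fintype .of_finite, Fintype.sum_prod_type, Finset.sum_div]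
  refine Finset.sum_congr rfl fun x _ => ?_
  simp [labelledLaw_real_singleton hg, sgn]
  ring

/-- The law of independent fair coins. -/
abbrev coinLaw (ρ : Type) [Fintype ρ] [DecidableEq ρ] : Measure (ρ → Bool) :=
  (PMF.uniformOfFintype (ρ → Bool)).toMeasure

theorem coinLaw_singleton (ρ : Type) [Fintype ρ] [DecidableEq ρ] (u : ρ → Bool) :
    coinLaw ρ {u} = (2 ^ Fintype.card ρ)⁻¹ := by
  rw [coinLaw, PMF.toMeasure_uniformOfFintype_apply _ (measurableSet_singleton u)]
  simp

theorem coinLaw_real_singleton (ρ : Type) [Fintype ρ] [DecidableEq ρ] (u : ρ → Bool) :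
    (coinLaw ρ).real {u} = (2 ^ Fintype.card ρ)⁻¹ := by
  rw [measureReal_def, coinLaw_singleton]
  simp

theorem map_eq_of_singleton {Ω Ω' : Type*} [Countable Ω'] [MeasurableSpace Ω] [MeasurableSpace Ω']
    [DiscreteMeasurableSpace Ω] [MeasurableSingletonClass Ω'] {μ : Measure Ω} {ν : Measure Ω'}
    (e : Ω ≃ Ω') (h : ∀ ω, μ {ω} = ν {e ω}) : μ.map e = ν := by
  refine Measure.ext_of_singleton fun a => ?_
  rw [Measure.map_apply .of_discrete (measurableSet_singleton a), ← e.image_symm_eq_preimage,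
    Set.image_singleton, h, e.apply_symm_apply]

/-- A labelled point with noise added to the label. -/
def mixPoint {n : ℕ} (m : ℕ) (p : LabelledPoint n × (Option (Fin m) → Bool)) : LabelledPoint n :=
  (p.1.1, mix (p.2 none) m (fun i => p.2 (some i)) p.1.2)

theorem map_mixPoint {n : ℕ} {g : (Fin n → Bool) → ℝ} (hg : ∀ x, |g x| ≤ 1) (m : ℕ) :
    ((labelledLaw g).prod (coinLaw (Option (Fin m)))).map (mixPoint m) =
      labelledLaw fun x => g x / 2 ^ m := by
  have hg' : ∀ x, |g x / 2 ^ m| ≤ 1 := fun x => by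
    rw [abs_div, abs_of_pos (by positivity : (0 : ℝ) < 2 ^ m)]
    exact div_le_one_of_le₀ ((hg x).trans (one_le_pow₀ one_le_two)) (by positivity)
  have := labelledLaw_isProbabilityMeasure hg
  have := labelledLaw_isProbabilityMeasure hg'
  have : IsFiniteMeasure (((labelledLaw g).prod (coinLaw (Option (Fin m)))).map (mixPoint m)) :=
    inferInstance
  refine Measure.ext_of_measureReal_singleton fun ⟨x, b⟩ => ?_
  rw [map_measureReal_apply .of_discrete (measurableSet_singleton _),
    labelledLaw_real_singleton hg']
  change Measure.real _ {p | mixPoint m p = (x, b)} = _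
  rw [measureReal_setOf_eq_sum, Fintype.sum_prod_type, Fintype.sum_prod_type,
    Finset.sum_eq_single x]
  · have hprod (z : LabelledPoint n) (c : Option (Fin m) → Bool) :
        ((labelledLaw g).prod (coinLaw (Option (Fin m)))).real {(z, c)} =
          (labelledLaw g).real {z} * (2 ^ (m + 1))⁻¹ := by
      rw [← Set.singleton_prod_singleton, measureReal_prod_prod, coinLaw_real_singleton]
      simp
    -- An indicator that is affine in the sign reduces the count of coin outcomes to `sum_sgn_mix`.
    have hind (b' : Bool) : (if b' = b then (1 : ℝ) else 0) = (1 + sgn b * sgn b') / 2 := by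
      cases b <;> cases b' <;> norm_num [sgn]
    have hsum (y : Bool) : ∑ c : Option (Fin m) → Bool,
        (if mix (c none) m (fun i => c (some i)) y = b then (1 : ℝ) else 0) =
          2 ^ m + sgn b * sgn y := by
      rw [← (Equiv.piOptionEquivProd (β := fun _ : Option (Fin m) => Bool)).symm.sum_comp,
        Fintype.sum_prod_type]
      simp_rw [hind, ← Finset.sum_div, Finset.sum_add_distrib, ← Finset.mul_sum]
      have := sum_sgn_mix m y
      simp only [Equiv.piOptionEquivProd, Equiv.coe_fn_symm_mk] at this ⊢
      rw [this]
      simp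
      ring
    have hterm (y : Bool) : ∑ c : Option (Fin m) → Bool,
        (if mixPoint m ((x, y), c) = (x, b) then
          ((labelledLaw g).prod (coinLaw (Option (Fin m)))).real {((x, y), c)} else 0) =
        (labelledLaw g).real {(x, y)} * (2 ^ (m + 1))⁻¹ * (2 ^ m + sgn b * sgn y) := by
      rw [← hsum, Finset.mul_sum]
      refine Finset.sum_congr rfl fun c _ => ?_
      simp [hprod, mixPoint]
    simp_rw [hterm, labelledLaw_real_singleton hg]
    have h2 : (2 : ℝ) ^ m ≠ 0 := by positivity
    cases b <;> simp [sgn] <;> field_simp <;> ring_nf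
  · intro x' _ hx'
    refine Finset.sum_eq_zero fun y _ => Finset.sum_eq_zero fun c _ => if_neg ?_
    simp [mixPoint, hx']
  · simp

theorem abs_prod_sgn {n : ℕ} (S : Finset (Fin n)) (x : Fin n → Bool) :
    |∏ s ∈ S, sgn (x s)| = 1 := by
  rw [Finset.abs_prod]
  exact Finset.prod_eq_one fun s _ => by cases x s <;> simp [sgn]

/-! ### Testing a predictor on fresh samples -/

theorem sq_sgn (b : Bool) : sgn b ^ 2 = 1 := by cases b <;> simp [sgn]

-- Chebyshev's inequality: the variance is additive over the product measure, and each summand has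
-- variance at most `E f² ≤ 1`.
open ProbabilityTheory in
theorem measure_abs_sum_sub_ge {Ω : Type*} [Fintype Ω] [MeasurableSpace Ω]
    [MeasurableSingletonClass Ω] (μ : Measure Ω) [IsProbabilityMeasure μ] {f : Ω → ℝ}
    (hf : ∀ ω, f ω ^ 2 ≤ 1) (M : ℕ) {a : ℝ} (ha : 0 < a) :
    (Measure.pi fun _ : Fin M => μ) {z | a ≤ |∑ i, f (z i) - M * ∫ ω, f ω ∂μ|} ≤
      ENNReal.ofReal (M / a ^ 2) := by
  have hm : MemLp f 2 μ := MemLp.of_discrete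
  have hm' : ∀ i : Fin M, MemLp f 2 μ := fun _ => hm
  have hvar : Var[f; μ] ≤ 1 := by
    rw [variance_eq_sub hm]
    have : ∫ ω, (f ^ 2) ω ∂μ ≤ ∫ _, (1 : ℝ) ∂μ :=
      integral_mono .of_finite .of_finite hf
    rw [integral_const] at this
    simp only [probReal_univ, smul_eq_mul, mul_one] at this
    nlinarith [sq_nonneg (∫ ω, f ω ∂μ)]
  have h := meas_ge_le_variance_div_sq (μ := Measure.pi fun _ : Fin M => μ)
    (X := ∑ i, fun z : Fin M → Ω => f (z i)) MemLp.of_discrete ha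
  rw [variance_sum_pi hm'] at h
  have hmean : ∫ z, (∑ i, fun z : Fin M → Ω => f (z i)) z ∂(Measure.pi fun _ : Fin M => μ) =
      M * ∫ ω, f ω ∂μ := by
    simp_rw [Finset.sum_apply]
    rw [integral_finsetSum _ fun i _ => .of_finite]
    have (i : Fin M) : ∫ z, f (z i) ∂(Measure.pi fun _ : Fin M => μ) = ∫ ω, f ω ∂μ :=
      integral_comp_eval (μ := fun _ : Fin M => μ) hm.aestronglyMeasurable
    simp [this]
  rw [hmean] at h
  simp only [Finset.sum_apply] at h
  refine h.trans (ENNReal.ofReal_le_ofReal ?_)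
  gcongr
  calc _ ≤ ∑ i : Fin M, (1 : ℝ) := Finset.sum_le_sum fun _ _ => hvar
    _ = M := by simp

/-- Fubini, with the trivial bound 1 on the slices over `B`. Here `Ω` will carry the training
randomness and `Ω'` the test points, so the hypothesis is fixed while the test points are drawn. -/
theorem prod_measure_le {Ω Ω' : Type*} [MeasurableSpace Ω] [MeasurableSpace Ω']
    [DiscreteMeasurableSpace Ω] [DiscreteMeasurableSpace (Ω × Ω')]
    (μ : Measure Ω) (ν : Measure Ω') [IsProbabilityMeasure μ] [IsProbabilityMeasure ν]
    (E : Set (Ω × Ω')) (B : Set Ω) (δ : ENNReal) (h : ∀ a ∉ B, ν {b | (a, b) ∈ E} ≤ δ) :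
    (μ.prod ν) E ≤ μ B + δ := by
  rw [Measure.prod_apply .of_discrete]
  calc _ ≤ ∫⁻ a, (B.indicator 1 a + δ) ∂μ := by
        refine lintegral_mono fun a => ?_
        by_cases ha : a ∈ B
        · simp only [Set.indicator_of_mem ha, Pi.one_apply]
          exact prob_le_one.trans le_self_add
        · rw [Set.indicator_of_notMem ha, zero_add]
          exact h a ha
    _ = μ B + δ := by
        rw [lintegral_add_right _ measurable_const, lintegral_indicator_one .of_discrete]
        simp

/-! ### Excess risk -/

/-- The expected logistic loss of the value `h` when the label has mean `θ`. -/
def condLoss (θ h : ℝ) : ℝ := Real.log (2 * Real.cosh h) - θ * h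

theorem logisticLoss_sgn (h : ℝ) (b : Bool) : logisticLoss h (sgn b) = condLoss (sgn b) h := by
  have key (t : ℝ) : Real.log (1 + Real.exp (-2 * t)) = Real.log (2 * Real.cosh t) - t := by
    have : 1 + Real.exp (-2 * t) = 2 * Real.cosh t * Real.exp (-t) := by
      rw [Real.cosh_eq, mul_div_cancel₀ _ two_ne_zero, add_mul, ← Real.exp_add, ← Real.exp_add]
      simp
      ring
    rw [this, Real.log_mul (by positivity) (by positivity), Real.log_exp]
    ring
  have hb : Real.cosh (h * sgn b) = Real.cosh h := by cases b <;> simp [sgn]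
  rw [logisticLoss, mul_assoc, key, hb, condLoss]
  ring

theorem risk_labelledLaw {n : ℕ} {g : (Fin n → Bool) → ℝ} (hg : ∀ x, |g x| ≤ 1)
    (h : (Fin n → Bool) → ℝ) :
    risk (labelledLaw g) h = (∑ x, condLoss (g x) (h x)) / 2 ^ n := by
  rw [risk, integral_labelledLaw hg]
  congr 1
  refine Finset.sum_congr rfl fun x _ => ?_
  rw [logisticLoss_sgn, logisticLoss_sgn]
  simp only [condLoss, sgn, if_true, Bool.false_eq_true, if_false]
  ring

/-- With `d = h - α` and `θ = tanh α`, the addition formula gives `cosh h = cosh α * (cosh d + θ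
sinh d)`. The last factor is the average of `e^d` and `e^(-d)` with weights `(1 ± θ)/2`, so by
Jensen it is at least `e^(θ d)`. -/
theorem condLoss_tanh_le (α h : ℝ) : condLoss (Real.tanh α) α ≤ condLoss (Real.tanh α) h := by
  have hα := Real.cosh_pos α
  set θ := Real.tanh α with hθ
  have hc : Real.cosh h = Real.cosh α * (Real.cosh (h - α) + θ * Real.sinh (h - α)) := by
    have : h = α + (h - α) := by ring
    conv_lhs => rw [this, Real.cosh_add]
    rw [hθ, Real.tanh_eq_sinh_div_cosh]
    field_simp
  have h1 : |θ| < 1 := Real.abs_tanh_lt_one α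
  have h2 := abs_lt.1 h1
  have hJ : Real.exp (θ * (h - α)) ≤ Real.cosh (h - α) + θ * Real.sinh (h - α) := by
    have := convexOn_exp.2 (Set.mem_univ (h - α)) (Set.mem_univ (-(h - α)))
      (by linarith : 0 ≤ (1 + θ) / 2) (by linarith : 0 ≤ (1 - θ) / 2) (by ring)
    simp only [smul_eq_mul] at this
    rw [Real.cosh_eq, Real.sinh_eq]
    calc _ = Real.exp ((1 + θ) / 2 * (h - α) + (1 - θ) / 2 * (-(h - α))) := by congr 1; ring
      _ ≤ _ := this
      _ = _ := by ring
  have hp : 0 < Real.cosh (h - α) + θ * Real.sinh (h - α) := (Real.exp_pos _).trans_le hJ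
  have hl := Real.log_le_log (Real.exp_pos _) hJ
  rw [Real.log_exp] at hl
  rw [condLoss, condLoss, hc, ← mul_assoc, Real.log_mul (by positivity) hp.ne']
  linarith

/-- The optimal prediction `α` is at least as good as the prediction `tanh α`, whose loss is
estimated by `log (cosh u) ≤ u² / 2`. -/
theorem condLoss_zero_sub_ge (α : ℝ) :
    Real.tanh α ^ 2 / 2 ≤ condLoss (Real.tanh α) 0 - condLoss (Real.tanh α) α := by
  have h := condLoss_tanh_le α (Real.tanh α)
  have h1 : condLoss (Real.tanh α) (Real.tanh α) ≤
      Real.log 2 + Real.tanh α ^ 2 / 2 - Real.tanh α * Real.tanh α := by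
    rw [condLoss, Real.log_mul two_ne_zero (Real.cosh_pos _).ne']
    have := Real.log_le_log (Real.cosh_pos _) (Real.cosh_le_exp_half_sq (Real.tanh α))
    rw [Real.log_exp] at this
    linarith
  have h2 : condLoss (Real.tanh α) 0 = Real.log 2 := by simp [condLoss]
  nlinarith

theorem condLoss_zero_le {θ h : ℝ} (hθ : θ * h ≤ 0) : condLoss θ 0 ≤ condLoss θ h := by
  have : Real.log 2 ≤ Real.log (2 * Real.cosh h) :=
    Real.log_le_log two_pos (by linarith [Real.one_le_cosh h])
  simp only [condLoss, Real.cosh_zero, mul_one, mul_zero, sub_zero]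
  linarith

/-- If the excess risk of `h` is small then the sign bit of `h` is correlated with `χ`. -/
theorem correlation_ge {n : ℕ} {v h χ : (Fin n → Bool) → ℝ} {b : (Fin n → Bool) → Bool} {θ ε : ℝ}
    (hθ : 0 < θ) (hχ : ∀ x, |χ x| = 1) (hv : ∀ x, Real.tanh (v x) = θ * χ x)
    (hb : ∀ x, 0 ≤ sgn (b x) * h x)
    (hr : risk (labelledLaw fun x => Real.tanh (v x)) h -
      risk (labelledLaw fun x => Real.tanh (v x)) v ≤ ε) :
    1 - 4 * ε / θ ^ 2 ≤ (∑ x, sgn (b x) * χ x) / 2 ^ n := by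
  have hg (x) : |Real.tanh (v x)| ≤ 1 := (Real.abs_tanh_lt_one _).le
  rw [risk_labelledLaw hg, risk_labelledLaw hg, ← sub_div, ← Finset.sum_sub_distrib] at hr
  -- If the signs agree, the left side is `0` and optimality of `v x` suffices. If they differ, the
  -- left side is `θ² / 2`, and a prediction of the wrong sign is no better than the prediction `0`.
  have hx (x) : θ ^ 2 / 4 * (1 - sgn (b x) * χ x) ≤
      condLoss (Real.tanh (v x)) (h x) - condLoss (Real.tanh (v x)) (v x) := by
    have h1 := condLoss_tanh_le (v x) (h x)
    have h2 := condLoss_zero_sub_ge (v x)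
    have h3 := @condLoss_zero_le (Real.tanh (v x)) (h x)
    rw [hv] at h1 h2 h3 ⊢
    have hbx := hb x
    rcases (abs_eq one_pos.le).1 (hχ x) with hc | hc <;> cases hs : b x <;>
      simp only [hs, hc, sgn, if_true, if_false, Bool.false_eq_true] at h1 h2 h3 hbx ⊢
    · have := h3 (by nlinarith)
      nlinarith
    · nlinarith
    · nlinarith
    · have := h3 (by nlinarith)
      nlinarith
  have hsum := Finset.sum_le_sum fun x (_ : x ∈ Finset.univ) => hx x
  rw [← Finset.mul_sum, Finset.sum_sub_distrib] at hsum
  have hN : (0 : ℝ) < 2 ^ n := by positivity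
  simp only [Finset.sum_const, Finset.card_univ, Fintype.card_pi, Fintype.card_bool,
    Finset.prod_const, Fintype.card_fin, nsmul_eq_mul, mul_one, Nat.cast_pow,
    Nat.cast_ofNat] at hsum
  rw [div_le_iff₀ hN] at hr
  rw [le_div_iff₀ hN, sub_mul, sub_le_iff_le_add, one_mul, ← sub_le_iff_le_add', div_mul_eq_mul_div,
    le_div_iff₀ (by positivity)]
  nlinarith

/-- The inequality is weak because a zero magnitude may carry either sign bit. It lets the tester
read one output wire of the learner and do no arithmetic on the hypothesis. -/
theorem fixedPoint_sign (p : ℕ) {q : ℕ} (b : Fin (q + 1) → Bool) :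
    0 ≤ sgn (b 0) * fixedPoint p b := by
  rw [fixedPoint, mul_div_assoc, ← mul_assoc, ← sq, sq_sgn, one_mul]
  exact div_nonneg (Finset.sum_nonneg fun i _ => by split_ifs <;> positivity) (by positivity)

/-! ### Testers with arbitrary index types -/

/-- The bits of labelled points indexed by `ι`. -/
def pointBits {n : ℕ} {ι : Type} (z : ι → LabelledPoint n) (p : ι × Option (Fin n)) : Bool :=
  p.2.elim (z p.1).2 (z p.1).1

theorem sampleBits_eq_pointBits {n m : ℕ} (z : Fin m → LabelledPoint n) :
    sampleBits z = pointBits z := by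
  funext ⟨i, o⟩
  cases o <;> rfl

theorem pi_prod_coinLaw_singleton {n : ℕ} (D : Measure (LabelledPoint n)) [IsProbabilityMeasure D]
    {ι ρ : Type} [Fintype ι] [Fintype ρ] [DecidableEq ρ] (ω : (ι → LabelledPoint n) × (ρ → Bool)) :
    ((Measure.pi fun _ : ι => D).prod (coinLaw ρ)) {ω} =
      (∏ i, D {ω.1 i}) * (2 ^ Fintype.card ρ)⁻¹ := by
  obtain ⟨z, u⟩ := ω
  rw [← Set.singleton_prod_singleton, Measure.prod_prod, coinLaw_singleton, Measure.pi_singleton]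

theorem measureReal_setOf_map_equiv {Ω Ω' : Type*} [MeasurableSpace Ω] [MeasurableSpace Ω']
    [DiscreteMeasurableSpace Ω] [DiscreteMeasurableSpace Ω'] [Countable Ω'] {μ : Measure Ω}
    {ν : Measure Ω'}
    (e : Ω ≃ Ω') (h : ∀ ω, μ {ω} = ν {e ω}) (p : Ω' → Prop) :
    ν.real {ω | p ω} = μ.real {ω | p (e ω)} := by
  rw [← map_eq_of_singleton e h, map_measureReal_apply .of_discrete .of_discrete]
  rfl

theorem exists_tester {n s : ℕ} {ι ρ : Type} [Fintype ι] [Fintype ρ] [DecidableEq ρ]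
    {f : ((ι × Option (Fin n)) ⊕ ρ → Bool) → Unit → Bool} (hf : Computes f s) :
    ∃ A : Tester n, A.runtime ≤ Fintype.card ι + Fintype.card ρ + s ∧
      ∀ (D : Measure (LabelledPoint n)) [IsProbabilityMeasure D] (b : Bool),
        A.prob D b = ((Measure.pi fun _ : ι => D).prod (coinLaw ρ)).real
          {ω | f (Sum.elim (pointBits ω.1) ω.2) () = b} := by
  let eι := Fintype.equivFin ι
  let eρ := Fintype.equivFin ρ
  let σ : (ι × Option (Fin n)) ⊕ ρ →
      (Fin (Fintype.card ι) × Option (Fin n)) ⊕ Fin (Fintype.card ρ) :=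
    Sum.map (Prod.map eι id) eρ
  obtain ⟨C, hC, hC'⟩ := ((hf.comp (Computes.wires σ)).relabel
    (fun _ : Fin 1 => ())).exists_circuit
  refine ⟨⟨_, _, C⟩, by simp only [Tester.runtime]; omega, fun D _ b => ?_⟩
  rw [Tester.prob]
  simp only [hC']
  rw [sampleLaw, measureReal_setOf_map_equiv (μ := (Measure.pi fun _ : ι => D).prod (coinLaw ρ))
    ((Equiv.arrowCongr eι (.refl _)).prodCongr (Equiv.arrowCongr eρ (.refl _)))]
  · congr 1
    ext ω
    simp only [Set.mem_ofPred_eq]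
    suffices h : (Sum.elim (sampleBits (ω.1 ∘ eι.symm)) (ω.2 ∘ eρ.symm)) ∘ σ =
        Sum.elim (pointBits ω.1) ω.2 by
      rw [← h]
      rfl
    funext o
    rcases o with ⟨i, o⟩ | i
    · cases o <;> simp [σ, sampleBits, pointBits]
    · simp [σ]
  · intro ω
    rw [pi_prod_coinLaw_singleton]
    refine Eq.trans ?_ (pi_prod_coinLaw_singleton D _).symm
    simp only [Fintype.card_fin]
    congr 1
    exact (eι.symm.prod_comp fun i => D {ω.1 i}).symm

/-! ### From learners to testers -/

/-- The randomness of one run of a learner with noisy labels, followed by `M` test points. -/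
abbrev Run (n s m r M : ℕ) : Type :=
  (((Fin s → LabelledPoint n) × (Fin s × Option (Fin m) → Bool)) × (Fin r → Bool)) ×
    (Fin M → LabelledPoint n)

/-- The law of the randomness of one run. -/
abbrev runLaw {n : ℕ} (D : Measure (LabelledPoint n)) (s m r M : ℕ) : Measure (Run n s m r M) :=
  (((Measure.pi fun _ : Fin s => D).prod (coinLaw (Fin s × Option (Fin m)))).prod
    (coinLaw (Fin r))).prod (Measure.pi fun _ : Fin M => D)

/-- The randomness of `T` runs as one family of samples and one family of coins. -/
def runsEquiv (n s m r M T : ℕ) : (Fin T → Run n s m r M) ≃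
    (Fin T × (Fin s ⊕ Fin M) → LabelledPoint n) ×
      (Fin T × ((Fin s × Option (Fin m)) ⊕ Fin r) → Bool) where
  toFun ω := (fun p => Sum.elim (ω p.1).1.1.1 (ω p.1).2 p.2,
    fun p => Sum.elim (ω p.1).1.1.2 (ω p.1).1.2 p.2)
  invFun ω t := (((fun i => ω.1 (t, .inl i), fun i => ω.2 (t, .inl i)), fun i => ω.2 (t, .inr i)),
    fun i => ω.1 (t, .inr i))
  left_inv ω := rfl
  right_inv ω := by
    refine Prod.ext ?_ ?_
    · funext ⟨t, i⟩
      cases i <;> rfl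
    · funext ⟨t, i⟩
      cases i <;> rfl

theorem pi_runLaw_singleton {n : ℕ} (D : Measure (LabelledPoint n)) [IsProbabilityMeasure D]
    (s m r M T : ℕ) (ω : Fin T → Run n s m r M) :
    (Measure.pi fun _ : Fin T => runLaw D s m r M) {ω} =
      ((Measure.pi fun _ => D).prod (coinLaw _)) {runsEquiv n s m r M T ω} := by
  have h (t : Fin T) : runLaw D s m r M {ω t} =
      ((∏ i, D {(ω t).1.1.1 i}) * ∏ i, D {(ω t).2 i}) *
        ((2 ^ (s * (m + 1)))⁻¹ * (2 ^ r)⁻¹) := by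
    obtain ⟨⟨a, u⟩, z⟩ := ω t
    rw [← Set.singleton_prod_singleton, Measure.prod_prod, ← Set.singleton_prod_singleton,
      Measure.prod_prod, pi_prod_coinLaw_singleton, coinLaw_singleton, Measure.pi_singleton]
    simp only [Fintype.card_prod, Fintype.card_option, Fintype.card_fin]
    ring
  rw [Measure.pi_singleton, pi_prod_coinLaw_singleton]
  simp_rw [h]
  rw [Finset.prod_mul_distrib, Fintype.prod_prod_type]
  simp only [Fintype.prod_sum_type, runsEquiv]
  congr 1
  simp only [Fintype.card_prod, Fintype.card_option, Fintype.card_fin, Fintype.card_sum,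
    Finset.prod_const, Finset.card_univ]
  rw [← ENNReal.mul_inv (by simp) (by simp), ← ENNReal.inv_pow, ← pow_add, ← pow_mul, mul_comm T]

/-- Noise is added to the labels of all points. -/
def mixPoints {n s : ℕ} (m : ℕ) (p : (Fin s → LabelledPoint n) × (Fin s × Option (Fin m) → Bool)) :
    Fin s → LabelledPoint n :=
  fun i => mixPoint m (p.1 i, fun o => p.2 (i, o))

theorem map_mixPoints {n : ℕ} {g : (Fin n → Bool) → ℝ} (hg : ∀ x, |g x| ≤ 1) (s m : ℕ) :
    ((Measure.pi fun _ : Fin s => labelledLaw g).prod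
      (coinLaw (Fin s × Option (Fin m)))).map (mixPoints m) =
      Measure.pi fun _ : Fin s => labelledLaw fun x => g x / 2 ^ m := by
  have := labelledLaw_isProbabilityMeasure hg
  let e : (Fin s → LabelledPoint n) × (Fin s × Option (Fin m) → Bool) ≃
      (Fin s → LabelledPoint n × (Option (Fin m) → Bool)) :=
    { toFun := fun p i => (p.1 i, fun o => p.2 (i, o))
      invFun := fun q => (fun i => (q i).1, fun p => (q p.1).2 p.2)
      left_inv := fun _ => rfl
      right_inv := fun _ => rfl }
  have he := map_eq_of_singleton e
    (μ := (Measure.pi fun _ : Fin s => labelledLaw g).prod (coinLaw (Fin s × Option (Fin m))))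
    (ν := Measure.pi fun _ : Fin s => (labelledLaw g).prod (coinLaw (Option (Fin m)))) (by
      intro ω
      rw [pi_prod_coinLaw_singleton, Measure.pi_singleton]
      have (i : Fin s) : ((labelledLaw g).prod (coinLaw (Option (Fin m)))) {e ω i} =
          labelledLaw g {ω.1 i} * (2 ^ (m + 1))⁻¹ := by
        change ((labelledLaw g).prod (coinLaw (Option (Fin m))))
          {(ω.1 i, fun o => ω.2 (i, o))} = _
        rw [← Set.singleton_prod_singleton, Measure.prod_prod, coinLaw_singleton]
        simp
      simp_rw [this, Finset.prod_mul_distrib]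
      simp [← ENNReal.inv_pow, ← pow_mul, mul_comm s])
  have hcomp : mixPoints (n := n) (s := s) m = (fun q i => mixPoint m (q i)) ∘ e := rfl
  rw [hcomp, ← Measure.map_map .of_discrete .of_discrete, he,
    Measure.pi_map_pi fun _ => Measurable.of_discrete.aemeasurable]
  simp_rw [map_mixPoint hg]

/-- The sign bit of the hypothesis of a learner at `x`. -/
def Learner.signBit {n : ℕ} (A : Learner n) (z : Fin A.samples → LabelledPoint n)
    (u : Fin A.coins → Bool) (x : Fin n → Bool) : Bool :=
  A.circuit.eval (Sum.elim (pointBits z) (Sum.elim u x)) 0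

theorem Learner.signBit_mul_hypothesis {n : ℕ} (A : Learner n)
    (z : Fin A.samples → LabelledPoint n) (u : Fin A.coins → Bool) (x : Fin n → Bool) :
    0 ≤ sgn (A.signBit z u x) * A.hypothesis z u x := by
  rw [Learner.signBit, Learner.hypothesis, sampleBits_eq_pointBits]
  exact fixedPoint_sign _ _

/-- The empirical correlation, times `M`, of the sign of the hypothesis with the labels. -/
def Learner.score {n m M : ℕ} (A : Learner n) (ω : Run n A.samples m A.coins M) : ℝ :=
  ∑ j, sgn (A.signBit (mixPoints m ω.1.1) ω.1.2 (ω.2 j).1) * sgn (ω.2 j).2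

/-- The learner's circuit includes training, so it is copied in full, together with the gates that
add the noise, for each of the `T * M` pairs of a run and a test point. -/
theorem Learner.computes_votes {n : ℕ} (A : Learner n) (m M T : ℕ) :
    ∃ g : (((Fin T × (Fin A.samples ⊕ Fin M)) × Option (Fin n)) ⊕
        (Fin T × ((Fin A.samples × Option (Fin m)) ⊕ Fin A.coins)) → Bool) →
        Fin T × (Fin M ⊕ Fin M) → Bool,
      Computes g (T * M * (A.samples * (3 * m) + A.circuit.size)) ∧
      ∀ (ω : Fin T → Run n A.samples m A.coins M) (t : Fin T) (j : Fin M),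
        g (Sum.elim (pointBits (runsEquiv _ _ _ _ _ _ ω).1) (runsEquiv _ _ _ _ _ _ ω).2)
          (t, .inl j) = A.signBit (mixPoints m (ω t).1.1) (ω t).1.2 ((ω t).2 j).1 ∧
        g (Sum.elim (pointBits (runsEquiv _ _ _ _ _ _ ω).1) (runsEquiv _ _ _ _ _ _ ω).2)
          (t, .inr j) = ((ω t).2 j).2 := by
  let W : Type := ((Fin T × (Fin A.samples ⊕ Fin M)) × Option (Fin n)) ⊕
    (Fin T × ((Fin A.samples × Option (Fin m)) ⊕ Fin A.coins))
  -- Wiring of one copy: training labels come from the noise gates, training points and coins from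
  -- run `p.1`, and the evaluation point is test point `p.2` of that run.
  let ρ (p : Fin T × Fin M) : (Fin A.samples × Option (Fin n)) ⊕ (Fin A.coins ⊕ Fin n) →
      (Fin A.samples × Unit) ⊕ W :=
    Sum.elim
      (fun q => q.2.elim (.inl (q.1, ())) fun j => .inr (.inl ((p.1, .inl q.1), some j)))
      (Sum.elim (fun c => .inr (.inr (p.1, .inr c)))
        fun j => .inr (.inl ((p.1, .inr p.2), some j)))
  have h1 (p : Fin T × Fin M) := ((((Computes.family fun i : Fin A.samples =>
    computes_mix (ι := W) (.inr (p.1, .inl (i, none))) m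
      (fun k => .inr (p.1, .inl (i, some k))) (.inl ((p.1, .inl i), none))).pair
      (Computes.wires (ι := W) id)).relabel (ρ p)))
  have h2 (p : Fin T × Fin M) := ((Computes.of_circuit A.circuit).comp (h1 p)).relabel
    (fun _ : Unit => 0)
  have h3 := ((Computes.family h2).pair (Computes.wires (ι := W) id)).relabel
    (fun p : Fin T × (Fin M ⊕ Fin M) => Sum.elim
      (fun j => (Sum.inl ((p.1, j), ()) : ((Fin T × Fin M) × Unit) ⊕ W))
      (fun j => .inr (.inl ((p.1, .inr j), none))) p.2)
  refine ⟨_, h3.mono (by simp), fun ω t j => ⟨?_, rfl⟩⟩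
  simp only [Sum.elim_inl, Learner.signBit]
  congr 1
  funext o
  rcases o with ⟨i, _ | o⟩ | o | o <;> rfl

instance (n s m r M : ℕ) : DiscreteMeasurableSpace (Run n s m r M) := inferInstance

instance (n s m r M T : ℕ) : DiscreteMeasurableSpace (Fin T → Run n s m r M) :=
  have : ∀ _ : Fin T, MeasurableSingletonClass (Run n s m r M) := fun _ => inferInstance
  have : Countable (Fin T → Run n s m r M) := inferInstance
  have : MeasurableSingletonClass (Fin T → Run n s m r M) := Pi.instMeasurableSingletonClass
  inferInstance

theorem Learner.exists_tester {M T : ℕ} (hM : 0 < M) (hT : 0 < T) :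
    ∃ K : ℕ, ∀ (n m : ℕ) (A : Learner n), ∃ B : Tester n,
      B.runtime ≤ K * (m + 1) * A.runtime ∧
      ∀ (D : Measure (LabelledPoint n)) [IsProbabilityMeasure D],
        B.prob D true = (Measure.pi fun _ : Fin T => runLaw D A.samples m A.coins M).real
          {ω | ∃ t, (M : ℝ) / 5 ≤ A.score (ω t)} ∧
        B.prob D false = (Measure.pi fun _ : Fin T => runLaw D A.samples m A.coins M).real
          {ω | ∀ t, A.score (ω t) < (M : ℝ) / 5} := by
  classical
  have : Nonempty (Fin T × (Fin M ⊕ Fin M)) := ⟨(⟨0, hT⟩, .inl ⟨0, hM⟩)⟩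
  obtain ⟨s, hs⟩ := Computes.exists_forall (Fin T × (Fin M ⊕ Fin M))
  refine ⟨T * (M + 1) + T + 3 * T * M + s, fun n m A => ?_⟩
  obtain ⟨g, hg, hg'⟩ := A.computes_votes m M T
  -- The decision is a Boolean function of `2 T M` bits, so its circuit size `s` is independent of
  -- `n`, `m` and `A`.
  let dec : (Fin T × (Fin M ⊕ Fin M) → Bool) → Unit → Bool := fun x _ =>
    decide (∃ t, (M : ℝ) / 5 ≤ ∑ j, sgn (x (t, .inl j)) * sgn (x (t, .inr j)))
  obtain ⟨B, hB, hB'⟩ := _root_.exists_tester ((hs dec).comp hg)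
  have hdec (ω : Fin T → Run n A.samples m A.coins M) :
      dec (g (Sum.elim (pointBits (runsEquiv _ _ _ _ _ _ ω).1) (runsEquiv _ _ _ _ _ _ ω).2)) () =
        true ↔ ∃ t, (M : ℝ) / 5 ≤ A.score (ω t) := by
    simp only [dec, Learner.score, hg', decide_eq_true_iff]
  refine ⟨B, hB.trans ?_, fun D _ => ⟨?_, ?_⟩⟩
  · simp only [Fintype.card_prod, Fintype.card_sum, Fintype.card_option, Fintype.card_fin,
      Learner.runtime]
    -- The sign bit alone makes the runtime positive, so additive constants are absorbed into a
    -- multiple of it.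
    have h1 : 1 ≤ A.samples + A.coins + A.circuit.size + (A.digits + 1) := by omega
    generalize hr : A.samples + A.coins + A.circuit.size + (A.digits + 1) = r at h1
    have e1 : A.samples ≤ r := by omega
    have e2 : A.coins ≤ r := by omega
    have e3 : A.samples + A.coins ≤ r := by omega
    have e4 : A.samples + A.circuit.size ≤ r := by omega
    have f1 : T * (A.samples + M) ≤ T * (M + 1) * ((m + 1) * r) := by
      rw [mul_assoc]
      gcongr
      calc A.samples + M ≤ r + M * r := by nlinarith
        _ = (M + 1) * (1 * r) := by ring
        _ ≤ _ := by gcongr; omega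
    have f2 : T * (A.samples * (m + 1) + A.coins) ≤ T * ((m + 1) * r) := by
      gcongr
      calc A.samples * (m + 1) + A.coins ≤ (A.samples + A.coins) * (m + 1) := by nlinarith
        _ ≤ r * (m + 1) := by gcongr
        _ = _ := by ring
    have f3 : T * M * (A.samples * (3 * m) + A.circuit.size) ≤ 3 * T * M * ((m + 1) * r) := by
      calc _ ≤ T * M * (3 * ((m + 1) * r)) := by
            gcongr
            calc _ ≤ 3 * ((m + 1) * (A.samples + A.circuit.size)) := by nlinarith
              _ ≤ _ := by gcongr
        _ = _ := by ring
    have f4 : s ≤ s * ((m + 1) * r) := Nat.le_mul_of_pos_right _ (by positivity)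
    calc _ ≤ T * (M + 1) * ((m + 1) * r) + T * ((m + 1) * r) +
          (3 * T * M * ((m + 1) * r) + s * ((m + 1) * r)) := by gcongr
      _ = _ := by ring
  · rw [hB' D true, measureReal_setOf_map_equiv (runsEquiv n A.samples m A.coins M T)
      (pi_runLaw_singleton D A.samples m A.coins M T)]
    simp_rw [hdec]
  · rw [hB' D false, measureReal_setOf_map_equiv (runsEquiv n A.samples m A.coins M T)
      (pi_runLaw_singleton D A.samples m A.coins M T)]
    simp_rw [← Bool.not_eq_true, hdec, not_exists, not_le]

theorem integral_sgn_mul_sgn {n : ℕ} {g : (Fin n → Bool) → ℝ} (hg : ∀ x, |g x| ≤ 1)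
    (b : (Fin n → Bool) → Bool) :
    ∫ z, sgn (b z.1) * sgn z.2 ∂labelledLaw g = (∑ x, sgn (b x) * g x) / 2 ^ n := by
  rw [integral_labelledLaw hg]
  congr 1
  refine Finset.sum_congr rfl fun x _ => ?_
  simp only [sgn, if_true, Bool.false_eq_true, if_false]
  ring

/-- The empirical correlation of a predictor with the labels deviates from its mean by `1 / 5` with
probability at most `1 / 1000`. -/
theorem measure_score_deviates {n M : ℕ} (D : Measure (LabelledPoint n)) [IsProbabilityMeasure D]
    (hM : M = 25000) (b : (Fin n → Bool) → Bool) (E : Set (Fin M → LabelledPoint n))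
    (hE : ∀ z ∈ E, (M : ℝ) / 5 ≤
      |∑ i, sgn (b (z i).1) * sgn (z i).2 - M * ∫ z, sgn (b z.1) * sgn z.2 ∂D|) :
    (Measure.pi fun _ : Fin M => D) E ≤ ENNReal.ofReal (1 / 1000) := by
  have hMr : (M : ℝ) = 25000 := by exact_mod_cast hM
  have h := measure_abs_sum_sub_ge D (f := fun z => sgn (b z.1) * sgn z.2)
    (fun z => by rw [mul_pow, sq_sgn, sq_sgn, one_mul]) M (a := M / 5) (by rw [hMr]; norm_num)
  refine (measure_mono hE).trans (h.trans (ENNReal.ofReal_le_ofReal ?_))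
  -- The Chebyshev bound is `M / (M/5)² = 25 / M`, hence the value of `M`.
  rw [hMr]
  norm_num

/-- Uniform labels are independent of the points, so the score has mean zero whatever hypothesis was
trained. The exceptional set of training outcomes is therefore empty. -/
theorem measure_accept_uniform_le {n m M : ℕ} (A : Learner n) (hM : M = 25000) :
    (runLaw (uniformLaw n) A.samples m A.coins M) {ω | (M : ℝ) / 5 ≤ A.score ω} ≤
      ENNReal.ofReal (1 / 1000) := by
  have h0 : ∀ x : Fin n → Bool, |(fun _ => (0 : ℝ)) x| ≤ 1 := by simp
  have : IsProbabilityMeasure (uniformLaw n) := labelledLaw_isProbabilityMeasure h0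
  have h := prod_measure_le
    (((Measure.pi fun _ : Fin A.samples => uniformLaw n).prod
      (coinLaw (Fin A.samples × Option (Fin m)))).prod (coinLaw (Fin A.coins)))
    (Measure.pi fun _ : Fin M => uniformLaw n) {ω | (M : ℝ) / 5 ≤ A.score ω} ∅
    (ENNReal.ofReal (1 / 1000)) (fun a _ => by
      refine measure_score_deviates _ hM (A.signBit (mixPoints m a.1) a.2) _ fun z hz => ?_
      rw [uniformLaw, integral_sgn_mul_sgn h0]
      simp only [mul_zero, Finset.sum_const_zero, zero_div, sub_zero]
      exact le_trans hz (le_abs_self _))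
  simpa using h

/-- The term `1/3` covers failed training. Otherwise the sign has correlation at least `1 - 4/25 =
21/25` with the parity, hence at least `21/50` with the test labels, which exceeds the threshold
`1/5` by more than `1/5`. -/
theorem measure_reject_parity_le {n m M : ℕ} (A : Learner n) (hM : M = 25000) (N : TanhNet n)
    (S : Finset (Fin n)) {ε : ℝ} (hε : ε ≤ (1 / 2 / 2 ^ m) ^ 2 / 25)
    (hN : ∀ x, Real.tanh (N.value x) = 1 / 2 / 2 ^ m * ∏ s ∈ S, sgn (x s))
    (hA : 2 / 3 ≤ (sampleLaw N.law A.samples A.coins).real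
      {ω | risk N.law (A.hypothesis ω.1 ω.2) - risk N.law N.value ≤ ε}) :
    (runLaw (parityLaw S (1 / 4)) A.samples m A.coins M) {ω | A.score ω < (M : ℝ) / 5} ≤
      ENNReal.ofReal (1 / 3) + ENNReal.ofReal (1 / 1000) := by
  have hMr : (M : ℝ) = 25000 := by exact_mod_cast hM
  have hg : ∀ x : Fin n → Bool, |2 * (1 / 4) * ∏ s ∈ S, sgn (x s)| ≤ 1 := fun x => by
    rw [abs_mul, abs_prod_sgn]
    norm_num
  have hlaw : (labelledLaw fun x => 2 * (1 / 4) * (∏ s ∈ S, sgn (x s)) / 2 ^ m) = N.law := by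
    rw [TanhNet.law]
    congr 1
    funext x
    rw [hN]
    ring
  have : IsProbabilityMeasure (parityLaw S (1 / 4)) := labelledLaw_isProbabilityMeasure hg
  have : IsProbabilityMeasure N.law :=
    labelledLaw_isProbabilityMeasure fun _ => (Real.abs_tanh_lt_one _).le
  have hprob : IsProbabilityMeasure (sampleLaw N.law A.samples A.coins) := by
    rw [sampleLaw]
    infer_instance
  set G : Set ((Fin A.samples → LabelledPoint n) × (Fin A.coins → Bool)) :=
    {ω | risk N.law (A.hypothesis ω.1 ω.2) - risk N.law N.value ≤ ε} with hG
  have hGc : (sampleLaw N.law A.samples A.coins) Gᶜ ≤ ENNReal.ofReal (1 / 3) := by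
    rw [← ofReal_measureReal, probReal_compl_eq_one_sub .of_discrete]
    exact ENNReal.ofReal_le_ofReal (by linarith)
  have hB : (((Measure.pi fun _ : Fin A.samples => parityLaw S (1 / 4)).prod
      (coinLaw (Fin A.samples × Option (Fin m)))).prod (coinLaw (Fin A.coins)))
      {a | (mixPoints m a.1, a.2) ∉ G} ≤ ENNReal.ofReal (1 / 3) := by
    refine le_trans (le_of_eq ?_) hGc
    rw [sampleLaw, ← hlaw, ← map_mixPoints hg]
    conv_rhs => rw [← Measure.map_id (μ := (PMF.uniformOfFintype (Fin A.coins → Bool)).toMeasure)]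
    have : SFinite (((Measure.pi fun _ : Fin A.samples => parityLaw S (1 / 4)).prod
      (coinLaw (Fin A.samples × Option (Fin m)))).map (mixPoints m)) := inferInstance
    rw [Measure.map_prod_map _ _ .of_discrete measurable_id,
      Measure.map_apply .of_discrete .of_discrete]
    rfl
  refine (prod_measure_le _ (Measure.pi fun _ : Fin M => parityLaw S (1 / 4))
    {ω | A.score ω < (M : ℝ) / 5} {a | (mixPoints m a.1, a.2) ∉ G}
    (ENNReal.ofReal (1 / 1000)) fun a ha => ?_).trans (add_le_add_left hB _)
  have ha' : (mixPoints m a.1, a.2) ∈ G := not_not.1 ha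
  refine measure_score_deviates _ hM (A.signBit (mixPoints m a.1) a.2) _ fun z hz => ?_
  have hc := correlation_ge (by positivity) (abs_prod_sgn S) hN
    (A.signBit_mul_hypothesis (mixPoints m a.1) a.2) ha'
  have hε' : 4 * ε / (1 / 2 / 2 ^ m) ^ 2 ≤ 4 / 25 := by
    rw [div_le_iff₀ (by positivity)]
    linarith
  have hmean : ∫ z, sgn (A.signBit (mixPoints m a.1) a.2 z.1) * sgn z.2 ∂parityLaw S (1 / 4) =
      1 / 2 * ((∑ x, sgn (A.signBit (mixPoints m a.1) a.2 x) * ∏ s ∈ S, sgn (x s)) / 2 ^ n) := by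
    rw [parityLaw, integral_sgn_mul_sgn hg, eq_comm, ← mul_div_assoc, Finset.mul_sum]
    congr 1
    exact Finset.sum_congr rfl fun x _ => by ring
  have hz' : ∑ j, sgn (A.signBit (mixPoints m a.1) a.2 (z j).1) * sgn (z j).2 < (M : ℝ) / 5 := hz
  rw [hmean, abs_sub_comm]
  refine le_trans ?_ (le_abs_self _)
  rw [hMr] at hz' ⊢
  linarith

/-- A learner for networks that represent all `k`-sparse parities can be turned into a tester. -/
theorem exists_tester_solvesParity :
    ∃ K : ℕ, ∀ (n k m : ℕ) (F : Set (TanhNet n)) (ε : ℝ), ε ≤ (1 / 2 / 2 ^ m) ^ 2 / 25 →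
      (∀ S : Finset (Fin n), S.card = k → ∃ N ∈ F, ∀ x,
        Real.tanh (N.value x) = 1 / 2 / 2 ^ m * ∏ s ∈ S, sgn (x s)) →
      ∀ A : Learner n, A.Learns F ε →
        ∃ B : Tester n, B.SolvesParity k (1 / 4) ∧ B.runtime ≤ K * (m + 1) * A.runtime := by
  obtain ⟨M, hM⟩ : ∃ M : ℕ, M = 25000 := ⟨_, rfl⟩
  -- Parity is declared as soon as one run accepts. With six runs the errors are at most `6/1000` by
  -- the union bound and `(1/3 + 1/1000)^6 ≤ 4/1000` by independence, which sum to `1/100`.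
  obtain ⟨K, hK⟩ := Learner.exists_tester (M := M) (T := 6) (by omega) (by omega)
  refine ⟨K, fun n k m F ε hε hF A hA => ?_⟩
  obtain ⟨B, hB, hprob⟩ := hK n m A
  refine ⟨B, fun S hS => ?_, hB⟩
  obtain ⟨N, hNF, hN⟩ := hF S hS
  have : IsProbabilityMeasure (uniformLaw n) := labelledLaw_isProbabilityMeasure (by simp)
  have : IsProbabilityMeasure (parityLaw S (1 / 4)) :=
    labelledLaw_isProbabilityMeasure fun x => by
      rw [abs_mul, abs_prod_sgn]
      norm_num
  have h1 : B.prob (uniformLaw n) true ≤ 6 / 1000 := by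
    rw [(hprob _).1, Set.ofPred_exists]
    refine (measureReal_iUnion_fintype_le _).trans ?_
    have (t : Fin 6) : (Measure.pi fun _ : Fin 6 => runLaw (uniformLaw n) A.samples m A.coins M).real
        {ω | (M : ℝ) / 5 ≤ A.score (ω t)} ≤ 1 / 1000 := by
      refine ENNReal.toReal_le_of_le_ofReal (by norm_num) ?_
      refine le_trans (le_of_eq ?_) (measure_accept_uniform_le (m := m) A hM)
      exact (measurePreserving_eval (fun _ : Fin 6 =>
        runLaw (uniformLaw n) A.samples m A.coins M) t).measure_preimage
          (MeasurableSet.of_discrete (s := {ω : Run n A.samples m A.coins M |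
            (M : ℝ) / 5 ≤ A.score ω})).nullMeasurableSet
    calc _ ≤ ∑ t : Fin 6, (1 / 1000 : ℝ) := Finset.sum_le_sum fun t _ => this t
      _ = 6 / 1000 := by norm_num
  have h2 : B.prob (parityLaw S (1 / 4)) false ≤ (1 / 3 + 1 / 1000) ^ 6 := by
    rw [(hprob _).2]
    have hset : {ω : Fin 6 → Run n A.samples m A.coins M | ∀ t, A.score (ω t) < (M : ℝ) / 5} =
        Set.pi Set.univ fun _ => {ω | A.score ω < (M : ℝ) / 5} := by
      ext ω
      simp
    rw [hset, measureReal_def, Measure.pi_pi, ENNReal.toReal_prod, Finset.prod_const,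
      Finset.card_univ, Fintype.card_fin]
    refine pow_le_pow_left₀ ENNReal.toReal_nonneg ?_ 6
    refine ENNReal.toReal_le_of_le_ofReal (by norm_num) ?_
    rw [ENNReal.ofReal_add (by norm_num) (by norm_num)]
    exact measure_reject_parity_le A hM N S hε hN (hA N hNF)
  have h3 : ((1 : ℝ) / 3 + 1 / 1000) ^ 6 ≤ 4 / 1000 := by norm_num
  linarith

/-! ### Networks that compute parities -/

/-- On the points `a (2 t - k)`, `t ≤ k`, the function `φ t` is an affine combination of translates
of `tanh` whose coefficients have `ℓ₁` norm at most `B`. -/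
def TanhRepresents (k : ℕ) (a B : ℝ) (φ : ℕ → ℝ) : Prop :=
  ∃ (L : ℕ) (c : ℝ) (w d : Fin L → ℝ),
    (∀ t ≤ k, c + ∑ j, w j * Real.tanh (d j + a * (2 * t - k)) = φ t) ∧ ∑ j, |w j| ≤ B

/-- All units receive `a * ∑_{s ∈ S} x_s = a (2 t - k)`, where `t` counts the coordinates in `S`
equal to `+1`, and the parity is `(-1)^(k - t) = (-1)^(k + t)`. -/
theorem TanhRepresents.exists_net {n k : ℕ} {a B α R : ℝ}
    (h : TanhRepresents k a B fun t => α * (-1) ^ (k + t)) (ha : 0 ≤ a) (hR : B ≤ R)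
    (S : Finset (Fin n)) (hS : S.card = k) :
    ∃ N : TanhNet n, N.hiddenNorm = k * a ∧ N.outNorm = R ∧
      ∀ x, N.value x = α * ∏ s ∈ S, sgn (x s) := by
  obtain ⟨L, c, w, d, hval, hw⟩ := h
  -- Two identical units with output weights `r` and `-r` cancel in the value and raise the output
  -- norm to exactly `R`. They also ensure that the maximum defining `hiddenNorm` is over a nonempty
  -- set.
  set r := (R - ∑ j, |w j|) / 2 with hr
  have hr0 : 0 ≤ r := by rw [hr]; linarith
  refine ⟨⟨L + 2, c, Fin.cons r (Fin.cons (-r) w), Fin.cons 0 (Fin.cons 0 d),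
    fun _ i => if i ∈ S then a else 0⟩, ?_, ?_, fun x => ?_⟩
  · simp only [TanhNet.hiddenNorm]
    rw [ciSup_const]
    simp [apply_ite abs, abs_of_nonneg ha, hS]
  · simp only [TanhNet.outNorm, Fin.sum_univ_succ, Fin.cons_zero, Fin.cons_succ, abs_neg,
      abs_of_nonneg hr0]
    rw [hr]
    ring
  · set t := (S.filter fun s => x s = true).card with ht
    have htk : t ≤ k := hS ▸ Finset.card_filter_le _ _
    have hf : (S.filter fun s => ¬ x s = true).card = k - t := by
      have := Finset.card_filter_add_card_filter_not (s := S) (fun s => x s = true)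
      omega
    have hsum : ∑ i, (if i ∈ S then a else 0) * sgn (x i) = a * (2 * t - k) := by
      simp only [ite_mul, zero_mul, Finset.sum_ite_mem, Finset.univ_inter, ← Finset.mul_sum, sgn,
        Finset.sum_ite, Finset.sum_const, ← ht, hf, nsmul_eq_mul, Nat.cast_sub htk]
      ring
    have hprod : ∏ s ∈ S, sgn (x s) = (-1) ^ (k + t) := by
      simp only [sgn, Finset.prod_ite, Finset.prod_const, hf, one_pow, one_mul]
      rw [show k + t = (k - t) + 2 * t by omega, pow_add, pow_mul]
      simp
    simp only [TanhNet.value, Fin.sum_univ_succ, Fin.cons_zero, Fin.cons_succ, hsum, hprod,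
      ← hval t htk]
    ring

theorem tanh_monotone : Monotone Real.tanh := fun u v huv =>
  (Real.artanh_le_artanh_iff ⟨Real.neg_one_lt_tanh u, Real.tanh_lt_one u⟩
    ⟨Real.neg_one_lt_tanh v, Real.tanh_lt_one v⟩).1 (by simpa only [Real.artanh_tanh] using huv)

/-- The value `3/4` is what `4 tanh a - 2 ≥ 1` requires, the margin of diagonal dominance for steep
units. It amounts to `e^(2a) ≥ 7`. -/
theorem three_quarters_le_tanh {a : ℝ} (ha : 1 ≤ a) : 3 / 4 ≤ Real.tanh a := by
  have h1 : (7 : ℝ) ≤ Real.exp (2 * a) := by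
    have h2 : Real.exp 2 ≤ Real.exp (2 * a) := Real.exp_le_exp.2 (by linarith)
    have h3 : Real.exp 2 = Real.exp 1 * Real.exp 1 := by rw [← Real.exp_add]; norm_num
    have := Real.exp_one_gt_d9
    nlinarith
  rw [Real.tanh_eq_sinh_div_cosh, Real.sinh_eq, Real.cosh_eq, div_div_div_cancel_right₀ two_ne_zero,
    le_div_iff₀ (by positivity)]
  have h4 : Real.exp (2 * a) * Real.exp (-a) = Real.exp a := by
    rw [← Real.exp_add]
    congr 1
    ring
  nlinarith [Real.exp_pos (-a)]

/-- Steep units represent every function with small increments. -/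
theorem tanhRepresents_of_one_le {k : ℕ} {a δ : ℝ} (ha : 1 ≤ a) (φ : ℕ → ℝ)
    (hφ : ∀ t, |φ (t + 1) - φ t| ≤ δ) : TanhRepresents k a (k * δ) φ := by
  have hT := three_quarters_le_tanh ha
  let τ (u : ℝ) : ℝ := Real.tanh (2 * a * u - a)
  have hτ : Monotone τ := fun u v huv => tanh_monotone (by nlinarith)
  have hτ0 : τ 0 = -Real.tanh a := by simp [τ]
  have hτ1 : τ 1 = Real.tanh a := by simp only [τ]; congr 1; ring
  have hτl (u : ℝ) : -1 < τ u := Real.neg_one_lt_tanh _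
  have hτu (u : ℝ) : τ u < 1 := Real.tanh_lt_one _
  -- `D i j` is the increment of unit `j` from point `i` to point `i + 1`. Rows telescope to at most
  -- 2, the total rise of `tanh`, and the diagonal `2 tanh a` takes most of it.
  let D : Matrix (Fin k) (Fin k) ℝ := fun i j => τ (i + 1 - j) - τ (i - j)
  have hD0 (i j) : 0 ≤ D i j := sub_nonneg.2 (hτ (by linarith))
  have hDd (i) : D i i = 2 * Real.tanh a := by
    simp only [D, sub_self, hτ0, add_sub_cancel_left, hτ1]
    ring
  have hDr (i) : ∑ j, D i j ≤ 2 := by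
    have : ∑ j, D i j = τ (i + 1) - τ (i + 1 - k) := by
      have := Finset.sum_range_sub' (fun j : ℕ => τ ((i : ℝ) + 1 - j)) k
      rw [Finset.sum_range] at this
      simp only [Nat.cast_zero, sub_zero] at this
      rw [← this]
      refine Finset.sum_congr rfl fun j _ => ?_
      simp only [D]
      congr 2
      push_cast
      ring
    rw [this]
    linarith [hτl ((i : ℝ) + 1 - k), hτu ((i : ℝ) + 1)]
  have hDo (i) : ∑ j ∈ Finset.univ.erase i, D i j ≤ 2 - 2 * Real.tanh a := by
    have := Finset.add_sum_erase Finset.univ (D i) (Finset.mem_univ i)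
    linarith [hDr i, hDd i]
  have hdet : D.det ≠ 0 := by
    refine det_ne_zero_of_sum_row_lt_diag fun i => ?_
    simp only [Real.norm_eq_abs, abs_of_nonneg (hD0 _ _)]
    linarith [hDo i, hDd i]
  set p : Fin k → ℝ := fun i => φ (i + 1) - φ i with hp
  obtain ⟨u, hu⟩ : ∃ u, D.mulVec u = p := ⟨D⁻¹.mulVec p, by
    rw [Matrix.mulVec_mulVec, Matrix.mul_nonsing_inv _ (isUnit_iff_ne_zero.2 hdet),
      Matrix.one_mulVec]⟩
  have hub (l) : |u l| ≤ δ := by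
    -- Row `i`, where `|u i|` is maximal, gives `(4 tanh a - 2) |u i| ≤ |p i| ≤ δ`.
    obtain ⟨i, -, hi⟩ := Finset.exists_max_image Finset.univ (fun i => |u i|) ⟨l, Finset.mem_univ l⟩
    refine (hi l (Finset.mem_univ l)).trans ?_
    have h1 : ∑ j, D i j * u j = p i := congrFun hu i
    rw [← Finset.add_sum_erase Finset.univ _ (Finset.mem_univ i), hDd] at h1
    have h2 : |∑ j ∈ Finset.univ.erase i, D i j * u j| ≤ (2 - 2 * Real.tanh a) * |u i| := by
      refine (Finset.abs_sum_le_sum_abs _ _).trans ?_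
      calc _ ≤ ∑ j ∈ Finset.univ.erase i, D i j * |u i| := by
            refine Finset.sum_le_sum fun j _ => ?_
            rw [abs_mul, abs_of_nonneg (hD0 _ _)]
            exact mul_le_mul_of_nonneg_left (hi j (Finset.mem_univ j)) (hD0 _ _)
        _ ≤ _ := by
            rw [← Finset.sum_mul]
            exact mul_le_mul_of_nonneg_right (hDo i) (abs_nonneg _)
    have h3 : |2 * Real.tanh a * u i| ≤ |p i| + |∑ j ∈ Finset.univ.erase i, D i j * u j| := by
      rw [eq_sub_of_add_eq h1]
      exact abs_sub _ _
    rw [abs_mul, abs_of_nonneg (by linarith : 0 ≤ 2 * Real.tanh a)] at h3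
    have h4 := hφ i
    have h5 : |p i| ≤ δ := h4
    nlinarith [abs_nonneg (u i)]
  -- The constant term gives the right value at `t = 0`; the increments then carry it to every `t ≤
  -- k`.
  refine ⟨k, φ 0 - ∑ j, u j * τ (0 - j), u, fun j => a * k - 2 * a * j - a, fun t ht => ?_, ?_⟩
  · have hrw (t : ℕ) (j : Fin k) :
        Real.tanh (a * k - 2 * a * j - a + a * (2 * t - k)) = τ (t - j) := by
      simp only [τ]
      congr 1
      ring
    simp_rw [hrw]
    induction t with
    | zero => simp
    | succ t ih =>
      have h1 : ∑ j, D ⟨t, ht⟩ j * u j = φ (t + 1) - φ t := congrFun hu ⟨t, ht⟩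
      have h2 := ih (by omega)
      have h3 : ∑ j, u j * τ ((t + 1 : ℕ) - (j : ℝ)) =
          ∑ j, u j * τ (t - j) + ∑ j, D ⟨t, ht⟩ j * u j := by
        rw [← Finset.sum_add_distrib]
        refine Finset.sum_congr rfl fun j _ => ?_
        simp only [D]
        push_cast
        ring
      rw [h3, h1, ← add_assoc, h2]
      ring
  · calc _ ≤ ∑ _j : Fin k, δ := Finset.sum_le_sum fun j _ => hub j
      _ = k * δ := by simp

open Lagrange in
/-- Solution of a Cauchy system by interpolation at the nodes `y t` and then at the poles. -/
theorem cauchy_system {y z φ : ℕ → ℝ} (Q : ℕ) (hy : ∀ t, 0 < y t) (hz : ∀ j, 0 < z j)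
    (hyi : Set.InjOn y (Finset.range Q)) (hzi : Set.InjOn z (Finset.range Q)) :
    ∀ t < Q, ∑ j ∈ Finset.range Q,
      nodalWeight (Finset.range Q) (fun i => -z i) j *
        ((∏ s ∈ Finset.range Q, (-z j - y s)) * ∑ s ∈ Finset.range Q,
          nodalWeight (Finset.range Q) y s * (-z j - y s)⁻¹ *
            (φ s * ∏ i ∈ Finset.range Q, (y s + z i))) / (y t + z j) = φ t := by
  intro t ht
  set r : ℕ → ℝ := fun s => φ s * ∏ i ∈ Finset.range Q, (y s + z i) with hr
  set P := interpolate (Finset.range Q) y r with hP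
  have hne (i j) : -z j ≠ y i := by linarith [hy i, hz j]
  have hzi' : Set.InjOn (fun i => -z i) (Finset.range Q) := fun i hi j hj hij =>
    hzi hi hj (neg_injective hij)
  -- Since `P` has degree less than `Q`, it is its own interpolant at the poles. Division by `∏ (y +
  -- z i)` turns this into the partial fraction expansion, whose values at the nodes `y t` are `φ
  -- t`.
  have h1 : P = interpolate (Finset.range Q) (fun i => -z i) fun i => P.eval (-z i) :=
    eq_interpolate hzi' (degree_interpolate_lt r hyi)
  have h2 (j) : P.eval (-z j) = (∏ s ∈ Finset.range Q, (-z j - y s)) *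
      ∑ s ∈ Finset.range Q, nodalWeight (Finset.range Q) y s * (-z j - y s)⁻¹ * r s := by
    rw [hP, eval_interpolate_not_at_node _ fun i _ => hne i j, eval_nodal]
  have h3 : P.eval (y t) = r t := eval_interpolate_at_node r hyi (Finset.mem_range.2 ht)
  rw [h1, eval_interpolate_not_at_node _ fun i _ => (hne t i).symm, eval_nodal, hr] at h3
  simp only [sub_neg_eq_add] at h3
  have h4 : ∏ i ∈ Finset.range Q, (y t + z i) ≠ 0 :=
    Finset.prod_ne_zero_iff.2 fun i _ => by linarith [hy t, hz i]
  rw [mul_comm (φ t)] at h3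
  rw [← mul_left_cancel₀ h4 h3]
  refine Finset.sum_congr rfl fun j _ => ?_
  rw [← h2]
  ring

open Lagrange in
theorem abs_nodalWeight_le {v : ℕ → ℝ} {Q i : ℕ} {d : ℝ} (hd : 1 ≤ d) (hi : i < Q)
    (hv : ∀ i < Q, ∀ j < Q, i ≠ j → d⁻¹ ≤ |v i - v j|) :
    |nodalWeight (Finset.range Q) v i| ≤ d ^ Q := by
  rw [nodalWeight, Finset.abs_prod]
  calc _ ≤ ∏ j ∈ (Finset.range Q).erase i, d := by
        refine Finset.prod_le_prod (fun _ _ => abs_nonneg _) fun j hj => ?_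
        rw [Finset.mem_erase, Finset.mem_range] at hj
        rw [abs_inv]
        exact inv_le_of_inv_le₀ (by positivity) (hv i hi j hj.2 hj.1.symm)
    _ = d ^ ((Finset.range Q).erase i).card := by simp
    _ ≤ d ^ Q := pow_le_pow_right₀ hd ((Finset.card_erase_le).trans (by simp))

/-- Flat units represent every function, with large coefficients. -/
theorem tanhRepresents_inv {k : ℕ} (hk : 0 < k) {α : ℝ} (φ : ℕ → ℝ) (hφ : ∀ t, |φ t| ≤ α) :
    TanhRepresents k (k : ℝ)⁻¹ (α * ((k : ℝ) + 1) ^ (36 * k)) φ := by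
  have hk0 : (0 : ℝ) < k := by exact_mod_cast hk
  have hα : 0 ≤ α := (abs_nonneg _).trans (hφ 0)
  set Q := k + 1 with hQ
  set q : ℝ := (k : ℝ) + 1 with hq
  have hqQ : (Q : ℝ) = q := by rw [hQ, hq]; push_cast; ring
  have hq2 : 2 ≤ q := by
    have : (1 : ℝ) ≤ k := by exact_mod_cast hk
    linarith
  -- For the unit with bias `1 - log (z j) / 2`, the input `u` satisfies `e^(2u) = y t / z j`. Hence
  -- `tanh u = 1 - 2 z j / (y t + z j)`, which is a Cauchy kernel up to an affine map.
  let y (t : ℕ) : ℝ := Real.exp (4 * t / k)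
  let z (j : ℕ) : ℝ := j + 1
  have hy (t) : 0 < y t := Real.exp_pos _
  have hz (j) : 0 < z j := by positivity
  have hz1 (j) : 1 ≤ z j := by simp [z]
  have hy81 {t : ℕ} (ht : t < Q) : y t ≤ 81 := by
    have h1 : (4 * t / k : ℝ) ≤ 4 := by
      rw [div_le_iff₀ hk0]
      have : (t : ℝ) ≤ k := by exact_mod_cast Nat.lt_succ_iff.1 ht
      linarith
    calc y t ≤ Real.exp 4 := Real.exp_le_exp.2 h1
      _ = Real.exp 1 ^ 4 := by rw [← Real.exp_nat_mul]; norm_num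
      _ ≤ 3 ^ 4 := pow_le_pow_left₀ (Real.exp_pos _).le
          (Real.exp_one_lt_d9.le.trans (by norm_num)) 4
      _ = 81 := by norm_num
  have hyd' {s t : ℕ} (h : s < t) : q⁻¹ ≤ y t - y s := by
    have hst : (s : ℝ) + 1 ≤ t := by exact_mod_cast h
    have h1 : (4 * t / k : ℝ) - 4 * s / k ≥ 4 / k := by
      rw [← sub_div, ge_iff_le]
      gcongr
      linarith
    have h2 : Real.exp (4 * t / k) = Real.exp (4 * s / k) * Real.exp (4 * t / k - 4 * s / k) := by
      rw [← Real.exp_add]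
      congr 1
      ring
    have h3 := Real.add_one_le_exp ((4 * t / k : ℝ) - 4 * s / k)
    have h4 : (1 : ℝ) ≤ Real.exp (4 * s / k) := Real.one_le_exp (by positivity)
    have h5 : q⁻¹ ≤ 4 / k := by
      rw [inv_le_comm₀ (by positivity) (by positivity), inv_div]
      linarith
    have h6 : (0 : ℝ) < 4 / k := by positivity
    simp only [y]
    rw [h2]
    nlinarith
  have hyd : ∀ i < Q, ∀ j < Q, i ≠ j → q⁻¹ ≤ |y i - y j| := by
    intro i _ j _ hij
    rcases lt_or_gt_of_ne hij with h | h
    · rw [abs_sub_comm]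
      exact (hyd' h).trans (le_abs_self _)
    · exact (hyd' h).trans (le_abs_self _)
  have hzd : ∀ i < Q, ∀ j < Q, i ≠ j → (1 : ℝ)⁻¹ ≤ |(fun i => -z i) i - (fun i => -z i) j| := by
    intro i _ j _ hij
    have h1 : (1 : ℤ) ≤ |(j : ℤ) - i| := Int.one_le_abs (by omega)
    have h2 : (1 : ℝ) ≤ |(j : ℝ) - i| := by exact_mod_cast h1
    simp only [z, inv_one]
    convert h2 using 2
    ring
  have hyi : Set.InjOn y (Finset.range Q) := fun i hi j hj hij => by
    by_contra hne
    have := hyd i (by simpa using hi) j (by simpa using hj) hne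
    rw [hij, sub_self, abs_zero] at this
    have : 0 < q⁻¹ := inv_pos.2 (by linarith)
    linarith
  have hzi : Set.InjOn z (Finset.range Q) := fun i _ j _ hij => by simpa [z] using hij
  have hsum {i s : ℕ} (hi : i < Q) (hs : s < Q) : y s + z i ≤ q ^ 7 := by
    have h1 : z i ≤ q := by
      have : (i : ℝ) ≤ k := by exact_mod_cast Nat.lt_succ_iff.1 hi
      simp only [z]
      linarith
    have h2 : (64 : ℝ) ≤ q ^ 6 := by
      calc (64 : ℝ) = 2 ^ 6 := by norm_num
        _ ≤ q ^ 6 := pow_le_pow_left₀ (by norm_num) hq2 6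
    have h3 : 64 * q ≤ q ^ 7 := by
      rw [pow_succ]
      gcongr
    linarith [hy81 hs]
  have hprod {s : ℕ} (hs : s < Q) : |∏ i ∈ Finset.range Q, (y s + z i)| ≤ (q ^ 7) ^ Q := by
    rw [Finset.abs_prod]
    calc _ ≤ ∏ i ∈ Finset.range Q, q ^ 7 := by
          refine Finset.prod_le_prod (fun _ _ => abs_nonneg _) fun i hi => ?_
          rw [abs_of_pos (add_pos (hy s) (hz i))]
          exact hsum (Finset.mem_range.1 hi) hs
      _ = _ := by simp
  have hprod' {j : ℕ} (hj : j < Q) : |∏ s ∈ Finset.range Q, (-z j - y s)| ≤ (q ^ 7) ^ Q := by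
    rw [Finset.abs_prod]
    calc _ ≤ ∏ i ∈ Finset.range Q, q ^ 7 := by
          refine Finset.prod_le_prod (fun _ _ => abs_nonneg _) fun s hs => ?_
          rw [show -z j - y s = -(y s + z j) by ring, abs_neg,
            abs_of_pos (add_pos (hy s) (hz j))]
          exact hsum hj (Finset.mem_range.1 hs)
      _ = _ := by simp
  let c (j : ℕ) : ℝ := Lagrange.nodalWeight (Finset.range Q) (fun i => -z i) j *
    ((∏ s ∈ Finset.range Q, (-z j - y s)) * ∑ s ∈ Finset.range Q,
      Lagrange.nodalWeight (Finset.range Q) y s * (-z j - y s)⁻¹ *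
        (φ s * ∏ i ∈ Finset.range Q, (y s + z i)))
  have hcs : ∀ t < Q, ∑ j ∈ Finset.range Q, c j / (y t + z j) = φ t :=
    cauchy_system Q hy hz hyi hzi
  have hcb {j : ℕ} (hj : j < Q) : |c j| ≤ α * (q * q ^ (15 * Q)) := by
    have hterm : ∀ s ∈ Finset.range Q,
        |Lagrange.nodalWeight (Finset.range Q) y s * (-z j - y s)⁻¹ *
          (φ s * ∏ i ∈ Finset.range Q, (y s + z i))| ≤ q ^ Q * 1 * (α * (q ^ 7) ^ Q) := by
      intro s hs
      have hs' := Finset.mem_range.1 hs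
      rw [abs_mul, abs_mul, abs_mul]
      gcongr
      · exact abs_nodalWeight_le (by linarith) hs' hyd
      · rw [show -z j - y s = -(y s + z j) by ring, abs_inv, abs_neg,
          abs_of_pos (add_pos (hy s) (hz j))]
        exact inv_le_one_of_one_le₀ (by linarith [hy s, hz1 j])
      · exact hφ s
      · exact hprod hs'
    have hS := (Finset.abs_sum_le_sum_abs _ _).trans (Finset.sum_le_sum hterm)
    rw [Finset.sum_const, Finset.card_range, nsmul_eq_mul, hqQ] at hS
    simp only [c]
    rw [abs_mul, abs_mul]
    -- The poles are 1-separated and the nodes `1/q`-separated, which bounds the nodal weights by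
    -- `1` and `q^Q`. Each of the two products over `y + z` contributes `q^(7Q)`, and the sum over
    -- `s` a factor `q`.
    calc _ ≤ 1 ^ Q * ((q ^ 7) ^ Q * (q * (q ^ Q * 1 * (α * (q ^ 7) ^ Q)))) := by
          gcongr
          · exact abs_nodalWeight_le le_rfl hj hzd
          · exact hprod' hj
      _ = _ := by ring_nf
  -- The weight `-c j / (2 z j)` produces `c j / (y t + z j)` and a constant, which the outer bias
  -- removes.
  refine ⟨Q, -∑ j : Fin Q, -c j / (2 * z j), fun j => -c j / (2 * z j),
    fun j => 1 - Real.log (z j) / 2, fun t ht => ?_, ?_⟩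
  · rw [← hcs t (Nat.lt_succ_iff.2 ht), Finset.sum_range, ← Finset.sum_neg_distrib,
      ← Finset.sum_add_distrib]
    refine Finset.sum_congr rfl fun j _ => ?_
    have hzj := hz j
    have hyt := hy t
    set u : ℝ := 1 - Real.log (z j) / 2 + (k : ℝ)⁻¹ * (2 * t - k) with hu
    have hexp : Real.exp u * Real.exp u = y t / z j := by
      rw [← Real.exp_add, ← Real.exp_log hzj, ← Real.exp_sub]
      congr 1
      rw [hu]
      field_simp
      ring
    have htanh : Real.tanh u = 1 - 2 * z j / (y t + z j) := by
      have h1 : Real.tanh u = (Real.exp u * Real.exp u - 1) / (Real.exp u * Real.exp u + 1) := by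
        rw [Real.tanh_eq_sinh_div_cosh, Real.sinh_eq, Real.cosh_eq, Real.exp_neg]
        field_simp
      rw [h1, hexp]
      field_simp
      ring
    rw [htanh]
    field_simp
    ring
  · have hw (j : Fin Q) : |-c j / (2 * z j)| ≤ α * (q * q ^ (15 * Q)) := by
      refine le_trans ?_ (hcb j.2)
      rw [abs_div, abs_neg, abs_of_pos (by have := hz j; positivity : 0 < 2 * z j)]
      exact div_le_self (abs_nonneg _) (by linarith [hz1 j])
    calc _ ≤ ∑ _j : Fin Q, α * (q * q ^ (15 * Q)) := Finset.sum_le_sum fun j _ => hw j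
      _ = α * q ^ (15 * Q + 2) := by
          rw [Finset.sum_const, Finset.card_univ, Fintype.card_fin, nsmul_eq_mul, hqQ]
          ring
      _ ≤ α * q ^ (36 * k) := by
          gcongr
          · linarith
          -- With `Q = k + 1` this is `15 k + 17 ≤ 36 k`, valid because `k ≥ 1`.
          · omega

/-! ### Asymptotics -/

theorem isLittleO_natCast_rpow {p q : ℝ} (h : p < q) :
    (fun n : ℕ => (n : ℝ) ^ p) =o[atTop] fun n : ℕ => (n : ℝ) ^ q := by
  have h1 : (fun x : ℝ => x ^ p) =o[atTop] fun x : ℝ => x ^ q := by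
    refine isLittleO_of_tendsto' ?_ ?_
    · filter_upwards [eventually_gt_atTop 0] with x hx h0
      exact absurd h0 (Real.rpow_pos_of_pos hx q).ne'
    · refine (tendsto_rpow_neg_atTop (sub_pos.2 h)).congr' ?_
      filter_upwards [eventually_gt_atTop 0] with x hx
      rw [← Real.rpow_sub hx]
      congr 1
      ring
  exact h1.comp_tendsto tendsto_natCast_atTop_atTop

/-- Hardness of sparse parities carries over to families that represent them. -/
theorem requiresRuntime_of_represents (hard : SparseParityHard) {F : (n : ℕ) → Set (TanhNet n)}
    {ε e : ℕ → ℝ} (k m : ℕ → ℕ) (hk : ∀ n, 0 < k n)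
    (hko : ∃ δ : ℝ, 0 < δ ∧ (fun n => (k n : ℝ)) =o[atTop] fun n => (n : ℝ) ^ (1 - δ))
    (hkt : Tendsto k atTop atTop) {C : ℝ} (hC : 0 < C) (he : ∀ᶠ n in atTop, e n ≤ C * k n)
    (hm : ∀ᶠ n : ℕ in atTop, (m n : ℝ) + 1 ≤ n ^ 3)
    (hε : ∀ᶠ n in atTop, ε n ≤ (1 / 2 / 2 ^ m n) ^ 2 / 25)
    (hF : ∀ᶠ n in atTop, ∀ S : Finset (Fin n), S.card = k n → ∃ N ∈ F n, ∀ x,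
      Real.tanh (N.value x) = 1 / 2 / 2 ^ m n * ∏ s ∈ S, sgn (x s)) :
    RequiresRuntime F ε e := by
  obtain ⟨K, hK⟩ := exists_tester_solvesParity
  obtain ⟨c, hc, hhard⟩ := hard (1 / 4) (by norm_num) (by norm_num) k hk hko
  -- The reduction costs a factor `K (m + 1) ≤ n^4`. Since `c k ≥ 8` eventually, at least half of
  -- the exponent `c k` remains, and `C` converts `k` into `e`.
  refine ⟨c / (2 * C), by positivity, ?_⟩
  have hkc : ∀ᶠ n in atTop, 8 / c ≤ (k n : ℝ) :=
    (tendsto_natCast_atTop_atTop.comp hkt).eventually_ge_atTop _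
  filter_upwards [hhard, he, hm, hε, hF, hkc, eventually_ge_atTop K, eventually_ge_atTop 1]
    with n hhard he hm hε hF hkc hnK hn1 A hA
  obtain ⟨B, hB, hBr⟩ := hK n (k n) (m n) (F n) (ε n) hε hF A hA
  have hn : (1 : ℝ) ≤ n := by exact_mod_cast hn1
  have hn0 : (0 : ℝ) < n := by linarith
  have hnK' : (K : ℝ) ≤ n := by exact_mod_cast hnK
  have hBr' : (B.runtime : ℝ) ≤ K * (m n + 1) * A.runtime := by exact_mod_cast hBr
  have h1 : (n : ℝ) ^ (c * k n) ≤ (n : ℝ) ^ (4 : ℝ) * A.runtime := by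
    calc _ ≤ (B.runtime : ℝ) := hhard B hB
      _ ≤ K * (m n + 1) * A.runtime := hBr'
      _ ≤ n * n ^ 3 * A.runtime := by gcongr
      _ = _ := by
        norm_cast
        ring
  have h2 : (n : ℝ) ^ (c * k n - 4) ≤ A.runtime := by
    rw [Real.rpow_sub hn0, div_le_iff₀ (by positivity)]
    linarith
  refine le_trans (Real.rpow_le_rpow_of_exponent_le hn ?_) h2
  rw [div_le_iff₀ hc] at hkc
  calc c / (2 * C) * e n ≤ c / (2 * C) * (C * k n) := by gcongr
    _ = c * k n / 2 := by field_simp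
    _ ≤ c * k n - 4 := by linarith

theorem tendsto_div_log_atTop : Tendsto (fun x : ℝ => x / Real.log x) atTop atTop := by
  have h : Tendsto (fun x : ℝ => Real.log x / x) atTop (𝓝[>] 0) := by
    refine tendsto_nhdsWithin_iff.2 ⟨Real.isLittleO_log_id_atTop.tendsto_div_nhds_zero, ?_⟩
    filter_upwards [eventually_gt_atTop 1] with x hx
    have := Real.log_pos hx
    exact div_pos this (by linarith)
  refine h.inv_tendsto_nhdsGT_zero.congr fun x => ?_
  simp

/-- The degrees of parities that networks of size `exp (36 c L)` represent. -/
theorem exists_degrees {L : ℕ → ℝ} (hL : Tendsto L atTop atTop)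
    (hO : ∃ δ : ℝ, 0 < δ ∧ (fun n => L n / Real.log (L n)) =O[atTop] fun n => (n : ℝ) ^ (1 - δ))
    {c : ℝ} (hc : 0 < c) (hc1 : c ≤ 1 / 2) :
    ∃ k : ℕ → ℕ, (∀ n, 0 < k n) ∧
      (∃ δ : ℝ, 0 < δ ∧ (fun n => (k n : ℝ)) =o[atTop] fun n => (n : ℝ) ^ (1 - δ)) ∧
      Tendsto k atTop atTop ∧
      (∀ᶠ n in atTop, L n / Real.log (L n) ≤ 2 / c * k n) ∧
      ∀ᶠ n in atTop, ((k n : ℝ) + 1) ^ (36 * k n) ≤ Real.exp (36 * c * L n) := by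
  have he : Tendsto (fun n => c * (L n / Real.log (L n))) atTop atTop :=
    (tendsto_div_log_atTop.comp hL).const_mul_atTop hc
  -- This solves `k log k ≈ c L`; the maximum with 1 keeps `k` positive for the finitely many small
  -- values.
  let k (n : ℕ) : ℕ := max 1 ⌊c * (L n / Real.log (L n))⌋₊
  have hk : ∀ᶠ n in atTop, (k n : ℝ) ≤ c * (L n / Real.log (L n)) := by
    filter_upwards [he.eventually_ge_atTop 1] with n hn
    rw [Nat.cast_max, Nat.cast_one]
    exact max_le hn (Nat.floor_le (by linarith))
  refine ⟨k, fun n => lt_max_of_lt_left one_pos, ?_, ?_, ?_, ?_⟩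
  · obtain ⟨δ, hδ, hO⟩ := hO
    -- Half of `δ` is given up to pass from `O` to `o`.
    refine ⟨δ / 2, by positivity, ?_⟩
    have h1 : (fun n => (k n : ℝ)) =O[atTop] fun n => L n / Real.log (L n) := by
      refine IsBigO.of_bound c ?_
      filter_upwards [hk] with n hn
      rw [Real.norm_eq_abs, Nat.abs_cast]
      exact hn.trans (mul_le_mul_of_nonneg_left (le_abs_self _) hc.le)
    exact (h1.trans hO).trans_isLittleO (isLittleO_natCast_rpow (by linarith))
  · exact tendsto_atTop_mono (fun n => le_max_right _ _) (tendsto_nat_floor_atTop.comp he)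
  · refine Eventually.of_forall fun n => ?_
    have h1 := Nat.lt_floor_add_one (c * (L n / Real.log (L n)))
    have h2 : (⌊c * (L n / Real.log (L n))⌋₊ : ℝ) ≤ k n := by exact_mod_cast le_max_right _ _
    have h3 : (1 : ℝ) ≤ k n := by exact_mod_cast le_max_left _ _
    rw [div_mul_eq_mul_div, le_div_iff₀ hc]
    linarith
  · filter_upwards [hk, hL.eventually_ge_atTop (Real.exp 1)] with n hn hLn
    have h0 : 2 ≤ L n := by linarith [Real.add_one_le_exp 1]
    have h1 : 1 ≤ Real.log (L n) := by
      rwa [Real.le_log_iff_exp_le (by linarith)]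
    have h2 : L n / Real.log (L n) ≤ L n := div_le_self (by linarith) h1
    -- This uses `c ≤ 1/2` and `L ≥ 2`. It gives `log (k + 1) ≤ log L`, which cancels the
    -- denominator in the bound for `k`.
    have h3 : (k n : ℝ) + 1 ≤ L n := by nlinarith
    have h4 : (0 : ℝ) < (k n : ℝ) + 1 := by positivity
    rw [← Real.exp_log (pow_pos h4 _), Real.log_pow]
    refine Real.exp_le_exp.2 ?_
    push_cast
    have h5 : 0 ≤ Real.log ((k n : ℝ) + 1) :=
      Real.log_nonneg (by linarith [(k n).cast_nonneg (α := ℝ)])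
    calc _ ≤ 36 * (c * (L n / Real.log (L n))) * Real.log (L n) := by gcongr
      _ = _ := by field_simp

theorem artanh_le {θ : ℝ} (h0 : 0 ≤ θ) (h1 : θ ≤ 1 / 2) : Real.artanh θ ≤ 2 * θ := by
  have h2 : 0 < (1 + θ) / (1 - θ) := div_pos (by linarith) (by linarith)
  rw [Real.artanh_eq_half_log ⟨by linarith, by linarith⟩]
  have h3 := Real.log_le_sub_one_of_pos h2
  have h4 : (1 + θ) / (1 - θ) - 1 ≤ 4 * θ := by
    rw [sub_le_iff_le_add, div_le_iff₀ (by linarith)]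
    nlinarith
  linarith

theorem artanh_nonneg {θ : ℝ} (h0 : 0 ≤ θ) (h1 : θ ≤ 1 / 2) : 0 ≤ Real.artanh θ := by
  rw [← Real.artanh_zero]
  exact Real.artanh_le_artanh (by norm_num) (by linarith) h0

theorem tanh_artanh_mul {θ χ : ℝ} (h0 : 0 ≤ θ) (h1 : θ ≤ 1 / 2) (hχ : |χ| = 1) :
    Real.tanh (Real.artanh θ * χ) = θ * χ := by
  have h2 : Real.tanh (Real.artanh θ) = θ := Real.tanh_artanh ⟨by linarith, by linarith⟩
  rcases (abs_eq one_pos.le).1 hχ with h | h <;> simp [h, h2]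

/-- Networks with flat hidden units compute noisy parities. -/
theorem exists_net_flat {n k : ℕ} (hk : 0 < k) {θ R : ℝ} (h0 : 0 ≤ θ) (h1 : θ ≤ 1 / 2)
    (hR : 2 * θ * ((k : ℝ) + 1) ^ (36 * k) ≤ R) (S : Finset (Fin n)) (hS : S.card = k) :
    ∃ N : TanhNet n, (N.hiddenNorm ≤ 2 ∧ N.outNorm = R) ∧
      ∀ x, Real.tanh (N.value x) = θ * ∏ s ∈ S, sgn (x s) := by
  have hα := artanh_le h0 h1
  obtain ⟨N, hN, hN', hv⟩ := (tanhRepresents_inv hk (α := Real.artanh θ)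
    (fun t => Real.artanh θ * (-1) ^ (k + t)) fun t => by
      simp [abs_mul, abs_of_nonneg (artanh_nonneg h0 h1)]).exists_net (by positivity)
      (le_trans (by gcongr) hR) S hS
  refine ⟨N, ⟨?_, hN'⟩, fun x => ?_⟩
  · rw [hN, mul_inv_cancel₀ (by positivity)]
    norm_num
  · rw [hv, tanh_artanh_mul h0 h1 (abs_prod_sgn S x)]

/-- Networks with steep hidden units compute noisy parities. -/
theorem exists_net_steep {n k : ℕ} (hk : 0 < k) {l R : ℝ} (hl : (k : ℝ) ≤ l)
    (hR : 2 * (k : ℝ) ≤ R) (S : Finset (Fin n)) (hS : S.card = k) :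
    ∃ N : TanhNet n, (N.hiddenNorm = l ∧ N.outNorm = R) ∧
      ∀ x, Real.tanh (N.value x) = 1 / 2 * ∏ s ∈ S, sgn (x s) := by
  have hk0 : (0 : ℝ) < k := by exact_mod_cast hk
  have h0 := artanh_nonneg (θ := 1 / 2) (by norm_num) le_rfl
  have h1 := artanh_le (θ := 1 / 2) (by norm_num) le_rfl
  have ha : 1 ≤ l / k := (one_le_div hk0).2 hl
  obtain ⟨N, hN, hN', hv⟩ := (tanhRepresents_of_one_le (k := k) ha
    -- The increments have modulus `2 artanh (1/2)`, and `artanh (1/2) ≤ 1`.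
    (fun t => Real.artanh (1 / 2) * (-1) ^ (k + t)) (δ := 2) fun t => by
      have : Real.artanh (1 / 2) * (-1) ^ (k + (t + 1)) - Real.artanh (1 / 2) * (-1) ^ (k + t) =
          -(2 * Real.artanh (1 / 2)) * (-1) ^ (k + t) := by ring
      rw [this, abs_mul, abs_pow, abs_neg, abs_neg, abs_one, one_pow, mul_one,
        abs_of_nonneg (by positivity)]
      linarith).exists_net (by positivity) (le_trans (by linarith) hR) S hS
  refine ⟨N, ⟨?_, hN'⟩, fun x => ?_⟩
  · rw [hN, mul_div_cancel₀ _ hk0.ne']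
  · rw [hv, tanh_artanh_mul (by norm_num) le_rfl (abs_prod_sgn S x)]

/-! ### The three regimes -/

theorem hard_constant_error (hard : SparseParityHard) :
    ∃ ε₀ : ℝ, 0 < ε₀ ∧ ∀ R : ℕ → ℝ, Tendsto R atTop atTop →
      (∃ δ : ℝ, 0 < δ ∧ (fun n => logRatio (R n)) =O[atTop] fun n => (n : ℝ) ^ (1 - δ)) →
      ∃ F : (n : ℕ) → Set (TanhNet n),
        (∀ᶠ n in atTop, ∀ N ∈ F n, N.hiddenNorm ≤ 2 ∧ N.outNorm = R n) ∧
        RequiresRuntime F (fun _ => ε₀) (fun n => logRatio (R n / ε₀)) := by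
  -- Here `θ = 1/2` and `m = 0`, so the admissible error is `θ² / 25 = 1/100`. Taking `c = 1/36`
  -- below makes the norm bound `exp (log R) = R`.
  refine ⟨1 / 100, by norm_num, fun R hR hO =>
    ⟨fun n => {N | N.hiddenNorm ≤ 2 ∧ N.outNorm = R n}, .of_forall fun n N hN => hN, ?_⟩⟩
  have hL : Tendsto (fun n => Real.log (R n)) atTop atTop := Real.tendsto_log_atTop.comp hR
  obtain ⟨k, hk, hko, hkt, hke, hkn⟩ := exists_degrees hL hO (c := 1 / 36) (by norm_num)
    (by norm_num)
  -- The extra factor 2 pays for `log (R / ε₀) = log R + log 100 ≤ 2 log R`.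
  refine requiresRuntime_of_represents hard k (fun _ => 0) hk hko hkt (C := 2 * (2 / (1 / 36)))
    (by norm_num) ?_ ?_ (.of_forall fun n => by norm_num) ?_
  · filter_upwards [hke, hL.eventually_ge_atTop (Real.log 100), hL.eventually_gt_atTop 1,
      hR.eventually_gt_atTop 0] with n hn h1 h2 h3
    have h4 : Real.log (R n / (1 / 100)) = Real.log (R n) + Real.log 100 := by
      rw [← Real.log_mul h3.ne' (by norm_num)]
      congr 1
      ring
    have h5 : 0 < Real.log 100 := Real.log_pos (by norm_num)
    have h6 := Real.log_pos h2
    have h7 : Real.log (Real.log (R n)) ≤ Real.log (Real.log (R n) + Real.log 100) :=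
      Real.log_le_log (by linarith) (by linarith)
    rw [logRatio, h4, mul_assoc]
    calc _ ≤ 2 * Real.log (R n) / Real.log (Real.log (R n)) :=
          div_le_div₀ (by linarith) (by linarith) h6 h7
      _ = 2 * (Real.log (R n) / Real.log (Real.log (R n))) := by ring
      _ ≤ _ := by gcongr
  · filter_upwards [eventually_ge_atTop 1] with n hn
    have : (1 : ℝ) ≤ n := by exact_mod_cast hn
    simpa using one_le_pow₀ this
  · filter_upwards [hkn, hR.eventually_gt_atTop 0] with n hn h0 S hS
    obtain ⟨N, hN, hv⟩ := exists_net_flat (hk n) (θ := 1 / 2) (R := R n) (by norm_num) le_rfl (by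
      rw [show 36 * (1 / 36) * Real.log (R n) = Real.log (R n) by ring, Real.exp_log h0] at hn
      linarith) S hS
    exact ⟨N, hN, fun x => by rw [hv, pow_zero, div_one]⟩

/-- The bias of the model shrinks with the error: `2^m ≈ ε^(-1/4)` and `θ = 2^(-m)/2`. Then `ε ≤ θ²
/ 25` for small `ε`, while a parity of amplitude `θ` needs only norm `2 θ (k + 1)^(36 k) ≤ 1` when
`(k + 1)^(36 k) ≤ ε^(-1/4)`; this is the choice `c = 1/144`. -/
theorem hard_constant_norm (hard : SparseParityHard) :
    ∃ w₀ : ℝ, 0 < w₀ ∧ ∀ ε : ℕ → ℝ, (∀ n, 0 < ε n) → Tendsto ε atTop (𝓝 0) →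
      (∃ δ : ℝ, 0 < δ ∧ (fun n => logRatio (1 / ε n)) =O[atTop] fun n => (n : ℝ) ^ (1 - δ)) →
      ∃ F : (n : ℕ) → Set (TanhNet n),
        (∀ᶠ n in atTop, ∀ N ∈ F n, N.hiddenNorm ≤ 2 ∧ N.outNorm = w₀) ∧
        RequiresRuntime F ε (fun n => logRatio (w₀ / ε n)) := by
  refine ⟨1, one_pos, fun ε hε0 hε hO =>
    ⟨fun n => {N | N.hiddenNorm ≤ 2 ∧ N.outNorm = 1}, .of_forall fun n N hN => hN, ?_⟩⟩
  set L : ℕ → ℝ := fun n => Real.log (1 / ε n) with hLdef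
  have hL : Tendsto L atTop atTop := by
    refine Real.tendsto_log_atTop.comp ?_
    simp_rw [one_div]
    exact (tendsto_nhdsWithin_iff.2 ⟨hε, .of_forall hε0⟩ : Tendsto ε atTop
      (𝓝[>] 0)).inv_tendsto_nhdsGT_zero
  have hεL (n) : ε n = Real.exp (-L n) := by
    rw [hLdef, ← Real.log_inv, one_div, inv_inv, Real.exp_log (hε0 n)]
  have hlog2 : 0 < Real.log 2 := Real.log_pos (by norm_num)
  let m (n : ℕ) : ℕ := ⌈L n / (4 * Real.log 2)⌉₊
  have hpow (n) : (2 : ℝ) ^ m n = Real.exp (m n * Real.log 2) := by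
    rw [mul_comm, Real.exp_mul, Real.exp_log two_pos, Real.rpow_natCast]
  have hm1 (n) : Real.exp (L n / 4) ≤ 2 ^ m n := by
    rw [hpow, Real.exp_le_exp]
    have := Nat.le_ceil (L n / (4 * Real.log 2))
    calc L n / 4 = L n / (4 * Real.log 2) * Real.log 2 := by field_simp
      _ ≤ m n * Real.log 2 := by gcongr
  have hmL : ∀ᶠ n in atTop, (m n : ℝ) < L n / (4 * Real.log 2) + 1 := by
    filter_upwards [hL.eventually_ge_atTop 0] with n hn
    exact Nat.ceil_lt_add_one (by positivity)
  have hm2 : ∀ᶠ n in atTop, (2 : ℝ) ^ m n ≤ 2 * Real.exp (L n / 4) := by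
    filter_upwards [hmL] with n hn
    calc (2 : ℝ) ^ m n ≤ Real.exp (Real.log 2 + L n / 4) := by
          rw [hpow, Real.exp_le_exp]
          calc m n * Real.log 2 ≤ (L n / (4 * Real.log 2) + 1) * Real.log 2 := by gcongr
            _ = _ := by field_simp; ring
      _ = _ := by rw [Real.exp_add, Real.exp_log two_pos]
  obtain ⟨k, hk, hko, hkt, hke, hkn⟩ := exists_degrees hL hO (c := 1 / 144) (by norm_num)
    (by norm_num)
  refine requiresRuntime_of_represents hard k m hk hko hkt (C := 2 / (1 / 144))
    (by norm_num) hke ?_ ?_ ?_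
  · obtain ⟨δ, hδ, hO⟩ := hO
    obtain ⟨C, hC⟩ := hO.bound
    have hn := tendsto_natCast_atTop_atTop (R := ℝ)
    filter_upwards [hC, hmL, hL.eventually_gt_atTop 1, hn.eventually_ge_atTop 2,
      hn.eventually_ge_atTop (4 * C ^ 2 + 1)] with n hC hm hL1 hn2 hnC
    have h1 : L n / Real.log (L n) ≤ C * (n : ℝ) ^ (1 - δ) := by
      rw [Real.norm_of_nonneg (by positivity : 0 ≤ (n : ℝ) ^ (1 - δ))] at hC
      exact (le_abs_self _).trans hC
    have hlog : 0 < Real.log (L n) := Real.log_pos hL1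
    have h2 : 0 < L n / Real.log (L n) := div_pos (by linarith) hlog
    have h3 : (n : ℝ) ^ (1 - δ) ≤ n := by
      conv_rhs => rw [← Real.rpow_one (n : ℝ)]
      exact Real.rpow_le_rpow_of_exponent_le (by linarith) (by linarith)
    have hC0 : 0 < C := by
      by_contra hneg
      have := mul_nonneg (neg_nonneg.2 (not_lt.1 hneg)) (by positivity : 0 ≤ (n : ℝ) ^ (1 - δ))
      linarith
    have h4 : L n / Real.log (L n) ≤ C * n := h1.trans (by gcongr)
    have hs : 0 < √(L n) := Real.sqrt_pos.2 (by linarith)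
    have hss : √(L n) * √(L n) = L n := Real.mul_self_sqrt (by linarith)
    -- Inserted into `L ≤ C n log L`, this yields `L ≤ 4 C² n²`, so `m`, which is of order `L`,
    -- stays below `n^3`.
    have h5 : Real.log (L n) ≤ 2 * √(L n) := by
      have := Real.log_le_sub_one_of_pos hs
      rw [Real.log_sqrt (by linarith)] at this
      linarith
    rw [div_le_iff₀ hlog] at h4
    have h6 : √(L n) ≤ 2 * C * n := by
      have : √(L n) * √(L n) ≤ 2 * C * n * √(L n) := by
        calc _ = L n := hss
          _ ≤ C * n * Real.log (L n) := h4
          _ ≤ C * n * (2 * √(L n)) := by gcongr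
          _ = _ := by ring
      exact le_of_mul_le_mul_right this hs
    have h7 : L n ≤ 4 * C ^ 2 * n ^ 2 := by
      calc L n = √(L n) * √(L n) := hss.symm
        _ ≤ (2 * C * n) * (2 * C * n) := by gcongr
        _ = _ := by ring
    have h8 : L n / (4 * Real.log 2) ≤ L n :=
      div_le_self (by linarith) (by linarith [Real.log_two_gt_d9])
    calc (m n : ℝ) + 1 ≤ 4 * C ^ 2 * n ^ 2 + 2 := by linarith
      _ ≤ 4 * C ^ 2 * n ^ 2 + n ^ 2 := by nlinarith
      _ = (4 * C ^ 2 + 1) * n ^ 2 := by ring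
      _ ≤ n * n ^ 2 := by gcongr
      _ = _ := by ring
  · filter_upwards [hm2, hL.eventually_ge_atTop (2 * Real.log 400)] with n hm hLn
    have h1 : Real.exp (-L n / 2) ≤ 1 / 400 := by
      rw [show (1 / 400 : ℝ) = Real.exp (-Real.log 400) by
        rw [Real.exp_neg, Real.exp_log (by norm_num), one_div]]
      exact Real.exp_le_exp.2 (by linarith)
    have h2 : (0 : ℝ) < 2 ^ m n := by positivity
    have h3 : ε n * Real.exp (L n / 4) ^ 2 = Real.exp (-L n / 2) := by
      rw [hεL, ← Real.exp_nat_mul, ← Real.exp_add]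
      congr 1
      push_cast
      ring
    rw [div_pow, div_div, le_div_iff₀ (by positivity)]
    calc ε n * ((2 ^ m n) ^ 2 * 25) ≤ ε n * ((2 * Real.exp (L n / 4)) ^ 2 * 25) := by
          have := (hε0 n).le
          gcongr
      _ = 100 * (ε n * Real.exp (L n / 4) ^ 2) := by ring
      _ ≤ _ := by rw [h3]; linarith
  · filter_upwards [hkn] with n hn S hS
    have h2 : (1 : ℝ) ≤ 2 ^ m n := one_le_pow₀ one_le_two
    refine exists_net_flat (hk n) (θ := 1 / 2 / 2 ^ m n) (R := 1) (by positivity)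
      (div_le_self (by norm_num) h2) ?_ S hS
    rw [show 36 * (1 / 144) * L n = L n / 4 by ring] at hn
    calc _ = ((k n : ℝ) + 1) ^ (36 * k n) / 2 ^ m n := by ring
      _ ≤ 1 := div_le_one_of_le₀ (hn.trans (hm1 n)) (by positivity)

/-- Steep units need only `λ ≥ k` and norm `2 k`, so `k ≈ √n` is available with `λ = n log n` and
norm `2 √n`. For these values the claimed exponent is at most `√n ≤ 2 k`. -/
theorem hard_large_weights (hard : SparseParityHard) :
    ∃ (F : (n : ℕ) → Set (TanhNet n)) (lam R : ℕ → ℝ),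
      lam =Θ[atTop] (fun n => (n : ℝ) * Real.log n) ∧
      R =Θ[atTop] (fun n => √(n : ℝ)) ∧
      (∀ᶠ n in atTop, ∀ N ∈ F n, N.hiddenNorm = lam n ∧ N.outNorm = R n) ∧
      RequiresRuntime F (fun _ => 1 / 100)
        (fun n => √(lam n / Real.log (lam n) ^ 3) * Real.log (R n)) := by
  refine ⟨fun n => {N | N.hiddenNorm = n * Real.log n ∧ N.outNorm = 2 * √(n : ℝ)},
    fun n => n * Real.log n, fun n => 2 * √(n : ℝ), isTheta_refl _ _,
    (isTheta_refl _ _).const_mul_left two_ne_zero, .of_forall fun n N hN => hN, ?_⟩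
  let k (n : ℕ) : ℕ := max 1 n.sqrt
  have hks {n : ℕ} (hn : 1 ≤ n) : (k n : ℝ) ≤ √(n : ℝ) := by
    rw [Nat.cast_max, Nat.cast_one]
    exact max_le (Real.one_le_sqrt.2 (by exact_mod_cast hn)) Real.nat_sqrt_le_real_sqrt
  have hsk (n : ℕ) : √(n : ℝ) ≤ 2 * k n := by
    have h1 : √(n : ℝ) ≤ n.sqrt + 1 := Real.real_sqrt_le_nat_sqrt_succ
    have h2 : (n.sqrt : ℝ) ≤ k n := by exact_mod_cast le_max_right _ _
    have h3 : (1 : ℝ) ≤ k n := by exact_mod_cast le_max_left _ _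
    linarith
  have hlog := Real.tendsto_log_atTop.comp (tendsto_natCast_atTop_atTop (R := ℝ))
  refine requiresRuntime_of_represents hard k (fun _ => 0) (fun n => lt_max_of_lt_left one_pos)
    ⟨1 / 4, by norm_num, ?_⟩ ?_ (C := 2) two_pos ?_ ?_ (.of_forall fun n => by norm_num) ?_
  · have h1 : (fun n => (k n : ℝ)) =O[atTop] fun n : ℕ => (n : ℝ) ^ (1 / 2 : ℝ) := by
      refine IsBigO.of_bound 1 ?_
      filter_upwards [eventually_ge_atTop 1] with n hn
      rw [← Real.sqrt_eq_rpow, one_mul, Real.norm_eq_abs, Nat.abs_cast]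
      exact (hks hn).trans (le_abs_self _)
    exact h1.trans_isLittleO (isLittleO_natCast_rpow (by norm_num))
  · have h1 : Tendsto (fun n => (k n : ℝ)) atTop atTop :=
      tendsto_atTop_mono (fun n => by linarith [hsk n] : ∀ n : ℕ, √(n : ℝ) / 2 ≤ k n)
        ((Real.tendsto_sqrt_atTop.comp tendsto_natCast_atTop_atTop).atTop_div_const two_pos)
    exact tendsto_natCast_atTop_iff.1 h1
  · filter_upwards [hlog.eventually_ge_atTop (2 * Real.log 2), hlog.eventually_ge_atTop 1,
      eventually_ge_atTop 1] with n h2 h1 hn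
    simp only [Function.comp_apply] at h1 h2
    have hn0 : (1 : ℝ) ≤ n := by exact_mod_cast hn
    refine le_trans ?_ (hsk n)
    have h3 : Real.log n ≤ Real.log (n * Real.log n) :=
      Real.log_le_log (by linarith) (le_mul_of_one_le_right (by linarith) h1)
    have h4 : Real.log (2 * √(n : ℝ)) ≤ Real.log n := by
      rw [Real.log_mul two_ne_zero (by positivity), Real.log_sqrt (by linarith)]
      linarith
    have h5 : 0 ≤ Real.log (2 * √(n : ℝ)) :=
      Real.log_nonneg (by linarith [Real.one_le_sqrt.2 hn0])
    calc _ ≤ √(n * Real.log n / Real.log n ^ 3) * Real.log n := by gcongr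
      _ = √(n / Real.log n ^ 2) * Real.log n := by
        congr 2
        field_simp
      _ = √(n : ℝ) := by
        rw [Real.sqrt_div (by linarith), Real.sqrt_sq (by linarith)]
        field_simp
  · filter_upwards [eventually_ge_atTop 1] with n hn
    have : (1 : ℝ) ≤ n := by exact_mod_cast hn
    simpa using one_le_pow₀ this
  · filter_upwards [hlog.eventually_ge_atTop 1, eventually_ge_atTop 1] with n h1 hn S hS
    have hn0 : (1 : ℝ) ≤ n := by exact_mod_cast hn
    have h2 : √(n : ℝ) ≤ n := Real.sqrt_le_iff.2 ⟨by linarith, by nlinarith⟩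
    obtain ⟨N, hN, hv⟩ := exists_net_steep (lt_max_of_lt_left one_pos : 0 < k n)
      (l := n * Real.log n) (R := 2 * √(n : ℝ))
      ((hks hn).trans (h2.trans (le_mul_of_one_le_right (by linarith) h1)))
      (by linarith [hks hn]) S hS
    exact ⟨N, hN, fun x => by rw [hv, pow_zero, div_one]⟩

end

theorem mainTheorem5 (hard : SparseParityHard) :
    -- bounded `λ`, constant `ε`, and `‖w‖₁ = R n` growing
    (∃ ε₀ : ℝ, 0 < ε₀ ∧ ∀ R : ℕ → ℝ, Tendsto R atTop atTop →
      (∃ δ : ℝ, 0 < δ ∧ (fun n => logRatio (R n)) =O[atTop] fun n => (n : ℝ) ^ (1 - δ)) →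
      ∃ F : (n : ℕ) → Set (TanhNet n),
        (∀ᶠ n in atTop, ∀ N ∈ F n, N.hiddenNorm ≤ 2 ∧ N.outNorm = R n) ∧
        RequiresRuntime F (fun _ => ε₀) (fun n => logRatio (R n / ε₀))) ∧
    -- bounded `λ`, constant `‖w‖₁`, and `ε n` tending to `0`
    (∃ w₀ : ℝ, 0 < w₀ ∧ ∀ ε : ℕ → ℝ, (∀ n, 0 < ε n) → Tendsto ε atTop (𝓝 0) →
      (∃ δ : ℝ, 0 < δ ∧ (fun n => logRatio (1 / ε n)) =O[atTop] fun n => (n : ℝ) ^ (1 - δ)) →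
      ∃ F : (n : ℕ) → Set (TanhNet n),
        (∀ᶠ n in atTop, ∀ N ∈ F n, N.hiddenNorm ≤ 2 ∧ N.outNorm = w₀) ∧
        RequiresRuntime F ε (fun n => logRatio (w₀ / ε n))) ∧
    -- large `λ`, constant error
    (∃ (F : (n : ℕ) → Set (TanhNet n)) (lam R : ℕ → ℝ),
      lam =Θ[atTop] (fun n => (n : ℝ) * Real.log n) ∧
      R =Θ[atTop] (fun n => √(n : ℝ)) ∧
      (∀ᶠ n in atTop, ∀ N ∈ F n, N.hiddenNorm = lam n ∧ N.outNorm = R n) ∧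
      RequiresRuntime F (fun _ => 1 / 100)
        (fun n => √(lam n / Real.log (lam n) ^ 3) * Real.log (R n))) :=
  ⟨hard_constant_error hard, hard_constant_norm hard, hard_large_weights hard⟩
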